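/- Let $n\ge 1$ and let $S_1,\dots,S_n$ be elements of a nonzero unital $C^*$-algebra $A$ with $S_i^*S_i=1$ for all $i$ and $\sum_{i=1}^n S_iS_i^*=1$ (Cuntz isometries); if $n=1$, assume in addition that the unitary $S_1$ is universal, i.e. for every unitary $y$ of a unital $C^*$-algebra $B$ there is a unital $*$-homomorphism $C^*(S_1)\to B$ with $S_1\mapsto y$. Let $\mathcal S_n=\operatorname{span}\{1,S_i,S_i^*:1\le i\le n\}\subseteq A$ be the operator system they generate. Let $E_{ij}$ $(0\le i,j\le n)$ be the matrix units of $M_{n+1}(\mathbb C)$, and consider the operator system $$\mathcal E_n=\operatorname{span}\Bigl\{E_{00},E_{0i},E_{i0},\sum_{j=1}^nE_{jj}:1\le i\le n\Bigr\}\subseteq M_{n+1}(\mathbb C)$$ and the subspace $J=\operatorname{span}\{E_{00}-\sum_{j=1}^nE_{jj}\}\subseteq \mathcal E_n$. Put $R=\frac{\sqrt2}{2}(1,S_1^*,\dots,S_n^*)$, let $\psi:M_{n+1}(\mathbb C)\to A$ be the linear map with $\psi(E_{ij})=(R^*R)_{ij}$, and let $\phi:\mathcal E_n\to\mathcal S_n$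 be the restriction of $\psi$. For an operator system $\mathcal S$ with unit $1$ and a kernel $J\subseteq\mathcal S$ (the kernel of a unital completely positive map from $\mathcal S$ to an operator system), the quotient operator system $\mathcal S/J$ has unit $1+J$ and the matrix cones $$C_k=\{(x_{ij}+J)\in M_k(\mathcal S/J):\ \forall \varepsilon>0\ \exists (\kappa_{ij})\in M_k(J),\ \varepsilon\otimes I_k+(x_{ij}+\kappa_{ij})\in M_k(\mathcal S)^+\}.$$ A complete order isomorphism is a unital linear isomorphism which is completely positive together with its inverse. A completely positive map $f:\mathcal S\to\mathcal T$ between operator systems is a complete quotient map if $\ker f$ is a kernel and the induced map $\mathcal S/\ker f\to\mathcal T$ is a complete order isomorphism. Theorem. The maps $\psi$ and $\phi$ are unital and completely positive, and $\ker\phi=J$; in particular $J$ is a kernel. The induced map $\mathcal E_n/J\to\mathcal S_n$, $x+J\mapsto\phi(x)$, is a (well-defined, bijective) complete order isomorphism. Hence $\phi$ is a complete quotient map. -/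

import Mathlib

open scoped ComplexOrder CStarAlgebra

universe u v w

/-- `X* M X` for a scalar matrix `X` and a matrix `M` with entries in a complex vector space. -/
noncomputable def matrixCompress {V : Type*} [AddCommGroup V] [Module ℂ V] {k m : ℕ}
    (X : Matrix (Fin k) (Fin m) ℂ) (M : Matrix (Fin k) (Fin k) V) : Matrix (Fin m) (Fin m) V :=
  Matrix.of fun i j => ∑ a, ∑ b, (star (X a i) * X b j) • M a b

/-- An (abstract) operator system on the complex vector space `V`: a matrix-ordered `*`-vector space
with an Archimedean matrix order unit `unit`. `cone k` is the cone `M_k(V)^+`. -/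
structure OperatorSystem (V : Type u) [AddCommGroup V] [Module ℂ V] where
  /-- the conjugate-linear involution -/
  adj : V →ₛₗ[starRingEnd ℂ] V
  adj_adj : ∀ x, adj (adj x) = x
  /-- the unit -/
  unit : V
  /-- the positive cones of the matrix spaces -/
  cone : ∀ k : ℕ, Set (Matrix (Fin k) (Fin k) V)
  cone_adj : ∀ k, ∀ M ∈ cone k, ∀ i j, adj (M j i) = M i j
  cone_add : ∀ k, ∀ M ∈ cone k, ∀ N ∈ cone k, M + N ∈ cone k
  cone_compress : ∀ k m (X : Matrix (Fin k) (Fin m) ℂ), ∀ M ∈ cone k, matrixCompress X M ∈ cone m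
  cone_proper : ∀ k M, M ∈ cone k → -M ∈ cone k → M = 0
  exists_unit_add_mem : ∀ k (M : Matrix (Fin k) (Fin k) V), (∀ i j, adj (M j i) = M i j) →
    ∃ r : ℝ, 0 < r ∧ Matrix.diagonal (fun _ => (r : ℂ) • unit) + M ∈ cone k
  archimedean : ∀ k (M : Matrix (Fin k) (Fin k) V),
    (∀ ε : ℝ, 0 < ε → Matrix.diagonal (fun _ => (ε : ℂ) • unit) + M ∈ cone k) → M ∈ cone k

namespace OperatorSystem

section Basic

variable {V : Type u} [AddCommGroup V] [Module ℂ V] {W : Type v} [AddCommGroup W] [Module ℂ W]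

/-- Complete positivity of a linear map between operator systems. -/
def IsCP (P : OperatorSystem V) (Q : OperatorSystem W) (f : V →ₗ[ℂ] W) : Prop :=
  ∀ k : ℕ, ∀ M ∈ P.cone k, M.map f ∈ Q.cone k

/-- Unital completely positive maps. -/
structure IsUCP (P : OperatorSystem V) (Q : OperatorSystem W) (f : V →ₗ[ℂ] W) : Prop where
  map_unit : f P.unit = Q.unit
  isCP : P.IsCP Q f

/-- (Unital) complete order isomorphisms. -/
structure IsCompleteOrderIso (P : OperatorSystem V) (Q : OperatorSystem W) (e : V ≃ₗ[ℂ] W) :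
    Prop where
  map_unit : e P.unit = Q.unit
  isCP : P.IsCP Q (e : V →ₗ[ℂ] W)
  symm_isCP : Q.IsCP P (e.symm : W →ₗ[ℂ] V)

/-- A kernel is the kernel of a unital completely positive map into some operator system. -/
def IsKernel (P : OperatorSystem V) (J : Submodule ℂ V) : Prop :=
  ∃ (W : Type w) (_ : AddCommGroup W) (_ : Module ℂ W) (Q : OperatorSystem W) (f : V →ₗ[ℂ] W),
    P.IsUCP Q f ∧ LinearMap.ker f = J

theorem cone_smul (P : OperatorSystem V) {k : ℕ} {M : Matrix (Fin k) (Fin k) V} (hM : M ∈ P.cone k)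
    {r : ℝ} (hr : 0 ≤ r) : (r : ℂ) • M ∈ P.cone k := by
  have h := P.cone_compress k k (Matrix.diagonal fun _ => ((Real.sqrt r : ℝ) : ℂ)) M hM
  convert h using 1
  ext i j
  simp only [matrixCompress, Matrix.of_apply, Matrix.smul_apply]
  rw [Finset.sum_eq_single i, Finset.sum_eq_single j]
  · simp only [Matrix.diagonal_apply_eq, Complex.star_def, Complex.conj_ofReal]
    rw [← Complex.ofReal_mul, Real.mul_self_sqrt hr]
  · intro b _ hb
    simp [Matrix.diagonal_apply_ne _ hb]
  · simp
  · intro a _ ha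
    simp [Matrix.diagonal_apply_ne _ ha]
  · simp

theorem adj_unit (P : OperatorSystem V) : P.adj P.unit = P.unit := by
  obtain ⟨r, hr, h⟩ := P.exists_unit_add_mem 1 0 (by simp)
  have h2 := P.cone_adj 1 _ h 0 0
  simp only [add_zero, Matrix.diagonal_apply_eq, LinearMap.map_smulₛₗ, Complex.conj_ofReal] at h2
  exact smul_right_injective V (Complex.ofReal_ne_zero.2 hr.ne') h2

theorem IsUCP.map_diagonal {P : OperatorSystem V} {Q : OperatorSystem W} {f : V →ₗ[ℂ] W}
    (hf : P.IsUCP Q f) {k : ℕ} (c : ℂ) :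
    (Matrix.diagonal (fun _ : Fin k => c • P.unit)).map f =
      Matrix.diagonal (fun _ => c • Q.unit) := by
  rw [Matrix.diagonal_map (map_zero f)]
  congr 1
  funext i
  simp [hf.map_unit]

theorem IsUCP.map_adj {P : OperatorSystem V} {Q : OperatorSystem W} {f : V →ₗ[ℂ] W}
    (hf : P.IsUCP Q f) (x : V) : f (P.adj x) = Q.adj (f x) := by
  have key : ∀ y, P.adj y = y → Q.adj (f y) = f y := by
    intro y hy
    obtain ⟨r, hr, h⟩ := P.exists_unit_add_mem 1 (Matrix.of fun _ _ => y) (by simp [hy])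
    have h2 := Q.cone_adj 1 _ (hf.isCP 1 _ h) 0 0
    simp only [Matrix.map_apply, Matrix.add_apply, Matrix.diagonal_apply_eq, Matrix.of_apply,
      map_add, map_smul, hf.map_unit, LinearMap.map_smulₛₗ, Complex.conj_ofReal, Q.adj_unit] at h2
    exact add_left_cancel h2
  have h1 := key (x + P.adj x) (by rw [map_add, P.adj_adj, add_comm])
  have h2 := key (Complex.I • (x - P.adj x)) (by
    rw [LinearMap.map_smulₛₗ, map_sub, P.adj_adj, Complex.conj_I, neg_smul, ← smul_neg, neg_sub])
  simp only [map_add, map_smul, map_sub, LinearMap.map_smulₛₗ, Complex.conj_I, neg_smul] at h1 h2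
  rw [← smul_neg] at h2
  have h3 := smul_right_injective W Complex.I_ne_zero h2
  have h4 : (2 : ℂ) • Q.adj (f x) = (2 : ℂ) • f (P.adj x) := by
    rw [two_smul, two_smul]
    have h5 := congrArg₂ (· - ·) h1 h3
    have e1 : Q.adj (f x) + Q.adj (f (P.adj x)) - -(Q.adj (f x) - Q.adj (f (P.adj x))) =
      Q.adj (f x) + Q.adj (f x) := by abel
    have e2 : f x + f (P.adj x) - (f x - f (P.adj x)) = f (P.adj x) + f (P.adj x) := by abel
    rw [e1, e2] at h5
    exact h5
  exact (smul_right_injective W (two_ne_zero' ℂ) h4).symm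

theorem IsKernel.adj_mem {P : OperatorSystem V} {J : Submodule ℂ V} (hJ : IsKernel.{u, w} P J)
    {x : V} (hx : x ∈ J) : P.adj x ∈ J := by
  obtain ⟨W, _, _, Q, f, hf, rfl⟩ := hJ
  rw [LinearMap.mem_ker] at hx ⊢
  rw [hf.map_adj, hx, map_zero]

/-- The cone `C_k` of the quotient of `P` by `J`: all `(x_ij + J)` such that for each `ε > 0` there
is `(κ_ij) ∈ M_k(J)` with `ε ⊗ I_k + (x_ij + κ_ij) ∈ M_k(P)^+`. -/
def quotientCone (P : OperatorSystem V) (J : Submodule ℂ V) (k : ℕ) :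
    Set (Matrix (Fin k) (Fin k) (V ⧸ J)) :=
  {M | ∃ x : Matrix (Fin k) (Fin k) V, x.map (Submodule.Quotient.mk (p := J)) = M ∧
    ∀ ε : ℝ, 0 < ε → ∃ κ : Matrix (Fin k) (Fin k) V, (∀ i j, κ i j ∈ J) ∧
      Matrix.diagonal (fun _ => (ε : ℂ) • P.unit) + (x + κ) ∈ P.cone k}

theorem matrixCompress_add {k m : ℕ} (X : Matrix (Fin k) (Fin m) ℂ)
    (M N : Matrix (Fin k) (Fin k) V) :
    matrixCompress X (M + N) = matrixCompress X M + matrixCompress X N := by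
  ext i j
  simp [matrixCompress, Finset.sum_add_distrib]

theorem matrixCompress_map {k m : ℕ} (X : Matrix (Fin k) (Fin m) ℂ)
    (M : Matrix (Fin k) (Fin k) V) (f : V →ₗ[ℂ] W) :
    matrixCompress X (M.map f) = (matrixCompress X M).map f := by
  ext i j
  simp [matrixCompress]

theorem mem_quotientCone_mk {P : OperatorSystem V} {J : Submodule ℂ V} {k : ℕ}
    {x : Matrix (Fin k) (Fin k) V} :
    x.map (Submodule.Quotient.mk (p := J)) ∈ P.quotientCone J k ↔
      ∀ ε : ℝ, 0 < ε → ∃ κ : Matrix (Fin k) (Fin k) V, (∀ i j, κ i j ∈ J) ∧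
        Matrix.diagonal (fun _ => (ε : ℂ) • P.unit) + (x + κ) ∈ P.cone k := by
  refine ⟨?_, fun h => ⟨x, rfl, h⟩⟩
  rintro ⟨y, hy, h⟩ ε hε
  obtain ⟨κ, hκ, h⟩ := h ε hε
  refine ⟨κ + (y - x), fun i j => ?_, ?_⟩
  · refine J.add_mem (hκ i j) ?_
    have := congrFun (congrFun hy i) j
    simpa using (Submodule.Quotient.eq J).1 this
  · convert h using 2
    abel

theorem exists_rep (J : Submodule ℂ V) {k : ℕ} (M : Matrix (Fin k) (Fin k) (V ⧸ J)) :
    ∃ x : Matrix (Fin k) (Fin k) V, x.map (Submodule.Quotient.mk (p := J)) = M := by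
  choose f hf using fun i j => Submodule.Quotient.mk_surjective J (M i j)
  exact ⟨Matrix.of f, by ext i j; exact hf i j⟩

theorem diagonal_add_diagonal (P : OperatorSystem V) (k : ℕ) (a b : ℝ) :
    Matrix.diagonal (fun _ : Fin k => ((a + b : ℝ) : ℂ) • P.unit) =
      Matrix.diagonal (fun _ => (a : ℂ) • P.unit) + Matrix.diagonal (fun _ => (b : ℂ) • P.unit) := by
  rw [Matrix.diagonal_add]
  congr 1
  funext i
  rw [Complex.ofReal_add, add_smul]

theorem smul_diagonal_unit (P : OperatorSystem V) (k : ℕ) (a b : ℝ) :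
    (a : ℂ) • Matrix.diagonal (fun _ : Fin k => (b : ℂ) • P.unit) =
      Matrix.diagonal (fun _ => ((a * b : ℝ) : ℂ) • P.unit) := by
  rw [← Matrix.diagonal_smul]
  congr 1
  funext i
  simp [mul_smul]

theorem diagonal_map_mk (P : OperatorSystem V) (J : Submodule ℂ V) (k : ℕ) (c : ℂ) :
    (Matrix.diagonal (fun _ : Fin k => c • P.unit)).map (Submodule.Quotient.mk (p := J)) =
      Matrix.diagonal (fun _ => c • (Submodule.Quotient.mk P.unit : V ⧸ J)) :=
  Matrix.diagonal_map rfl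

theorem map_mk_add (J : Submodule ℂ V) {k : ℕ} (x y : Matrix (Fin k) (Fin k) V) :
    x.map (Submodule.Quotient.mk (p := J)) + y.map (Submodule.Quotient.mk (p := J)) =
      (x + y).map (Submodule.Quotient.mk (p := J)) := rfl

/-- The quotient operator system `P / J` of an operator system by a kernel, with unit `1 + J` and
matrix cones `C_k`. -/
noncomputable def quotient (P : OperatorSystem V) (J : Submodule ℂ V)
    (hJ : IsKernel.{u, w} P J) : OperatorSystem (V ⧸ J) where
  adj := J.mapQ J P.adj fun _ hx => hJ.adj_mem hx
  adj_adj x := by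
    obtain ⟨x, rfl⟩ := Submodule.Quotient.mk_surjective J x
    simp [P.adj_adj]
  unit := Submodule.Quotient.mk P.unit
  cone := P.quotientCone J
  cone_adj k M hM i j := by
    obtain ⟨x, rfl, h⟩ := hM
    obtain ⟨κ, hκ, h⟩ := h 1 one_pos
    have h1 : P.adj (x j i + κ j i) = x i j + κ i j := by
      have h2 := P.cone_adj k _ h i j
      rw [Matrix.add_apply, Matrix.add_apply, map_add] at h2
      have h3 : P.adj (Matrix.diagonal (fun _ : Fin k => ((1 : ℝ) : ℂ) • P.unit) j i) =
          Matrix.diagonal (fun _ : Fin k => ((1 : ℝ) : ℂ) • P.unit) i j := by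
        by_cases hij : i = j
        · subst hij
          simp [P.adj_unit]
        · simp [Matrix.diagonal_apply_ne _ hij, Matrix.diagonal_apply_ne' _ hij]
      rw [h3] at h2
      exact add_left_cancel h2
    simp only [Matrix.map_apply, Submodule.mapQ_apply]
    rw [Submodule.Quotient.eq]
    have h2 : P.adj (x j i) - x i j = κ i j - P.adj (κ j i) := by
      rw [map_add] at h1
      rw [sub_eq_sub_iff_add_eq_add, h1, add_comm]
    rw [h2]
    exact J.sub_mem (hκ i j) (hJ.adj_mem (hκ j i))
  cone_add k M hM N hN := by
    obtain ⟨x, rfl⟩ := exists_rep J M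
    obtain ⟨y, rfl⟩ := exists_rep J N
    rw [map_mk_add, mem_quotientCone_mk]
    rw [mem_quotientCone_mk] at hM hN
    intro ε hε
    obtain ⟨κ, hκ, h⟩ := hM (ε / 2) (half_pos hε)
    obtain ⟨κ', hκ', h'⟩ := hN (ε / 2) (half_pos hε)
    refine ⟨κ + κ', fun i j => J.add_mem (hκ i j) (hκ' i j), ?_⟩
    convert P.cone_add k _ h _ h' using 1
    conv_lhs => rw [← add_halves ε, diagonal_add_diagonal]
    abel
  cone_compress k m X M hM := by
    obtain ⟨x, rfl⟩ := exists_rep J M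
    have e : matrixCompress X (x.map (Submodule.Quotient.mk (p := J))) =
        (matrixCompress X x).map (Submodule.Quotient.mk (p := J)) :=
      matrixCompress_map X x J.mkQ
    rw [e, mem_quotientCone_mk]
    rw [mem_quotientCone_mk] at hM
    intro ε hε
    have hsa : ∀ i j, P.adj ((-matrixCompress X
        (Matrix.diagonal fun _ => ((1 : ℝ) : ℂ) • P.unit)) j i) =
        (-matrixCompress X (Matrix.diagonal fun _ => ((1 : ℝ) : ℂ) • P.unit)) i j := by
      intro i j
      simp [matrixCompress, Matrix.diagonal_apply, P.adj_unit, mul_comm]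
    obtain ⟨r, hr, h1⟩ := P.exists_unit_add_mem m _ hsa
    obtain ⟨κ, hκ, h⟩ := hM (ε / r) (div_pos hε hr)
    refine ⟨matrixCompress X κ, fun i j => ?_, ?_⟩
    · simp only [matrixCompress, Matrix.of_apply]
      exact J.sum_mem fun a _ => J.sum_mem fun b _ => J.smul_mem _ (hκ a b)
    · have h2 := P.cone_smul h1 (div_pos hε hr).le
      convert P.cone_add m _ (P.cone_compress k m X _ h) _ h2 using 1
      rw [matrixCompress_add, matrixCompress_add, smul_add, smul_diagonal_unit,
        div_mul_cancel₀ _ hr.ne']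
      have h3 : matrixCompress X (Matrix.diagonal fun _ => ((ε / r : ℝ) : ℂ) • P.unit) =
          ((ε / r : ℝ) : ℂ) •
            matrixCompress X (Matrix.diagonal fun _ => ((1 : ℝ) : ℂ) • P.unit) := by
        ext i j
        simp only [matrixCompress, Matrix.of_apply, Matrix.smul_apply, Finset.smul_sum,
          Matrix.diagonal_apply]
        refine Finset.sum_congr rfl fun a _ => Finset.sum_congr rfl fun b _ => ?_
        split_ifs
        · simp only [smul_smul]
          congr 1
          push_cast
          ring
        · simp
      rw [h3, smul_neg]
      abel
  cone_proper k M hM hM' := by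
    obtain ⟨x, rfl⟩ := exists_rep J M
    have e : -(x.map (Submodule.Quotient.mk (p := J))) =
        (-x).map (Submodule.Quotient.mk (p := J)) := rfl
    rw [e, mem_quotientCone_mk] at hM'
    rw [mem_quotientCone_mk] at hM
    obtain ⟨W, _, _, Q, f, hf, rfl⟩ := hJ
    have key : ∀ y : Matrix (Fin k) (Fin k) V, (∀ ε : ℝ, 0 < ε → ∃ κ : Matrix (Fin k) (Fin k) V,
        (∀ i j, κ i j ∈ LinearMap.ker f) ∧
          Matrix.diagonal (fun _ => (ε : ℂ) • P.unit) + (y + κ) ∈ P.cone k) →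
          y.map f ∈ Q.cone k := by
      intro y hy
      refine Q.archimedean k _ fun ε hε => ?_
      obtain ⟨κ, hκ, h⟩ := hy ε hε
      have h1 := hf.isCP k _ h
      rw [Matrix.map_add _ (map_add f), Matrix.map_add _ (map_add f), hf.map_diagonal] at h1
      have h2 : κ.map f = 0 := by
        ext i j
        exact hκ i j
      rwa [h2, add_zero] at h1
    have h1 := key x hM
    have h2 := key (-x) hM'
    have h3 : (-x).map f = -(x.map f) := by
      ext i j
      simp
    rw [h3] at h2
    have h4 := Q.cone_proper k _ h1 h2
    ext i j
    simp only [Matrix.map_apply, Matrix.zero_apply, Submodule.Quotient.mk_eq_zero]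
    exact congrFun (congrFun h4 i) j
  exists_unit_add_mem k M hM := by
    obtain ⟨x, rfl⟩ := exists_rep J M
    let y : Matrix (Fin k) (Fin k) V := Matrix.of fun i j => (2⁻¹ : ℂ) • (x i j + P.adj (x j i))
    have hy : y.map (Submodule.Quotient.mk (p := J)) = x.map (Submodule.Quotient.mk (p := J)) := by
      ext i j
      have h := hM i j
      simp only [Matrix.map_apply, Submodule.mapQ_apply] at h
      simp only [Matrix.map_apply, y, Matrix.of_apply, Submodule.Quotient.mk_smul,
        Submodule.Quotient.mk_add, h]
      rw [← two_smul ℂ, smul_smul]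
      simp
    obtain ⟨r, hr, h⟩ := P.exists_unit_add_mem k y fun i j => by
      have h2 : (starRingEnd ℂ) (2⁻¹ : ℂ) = 2⁻¹ := by rw [map_inv₀, map_ofNat]
      simp only [y, Matrix.of_apply, LinearMap.map_smulₛₗ, map_add, P.adj_adj, h2]
      rw [add_comm]
    refine ⟨r, hr, ?_⟩
    rw [← hy, ← diagonal_map_mk, map_mk_add, mem_quotientCone_mk]
    intro ε hε
    refine ⟨0, fun i j => J.zero_mem, ?_⟩
    have h4 := P.exists_unit_add_mem k 0 (by simp)
    obtain ⟨s, hs, h4⟩ := h4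
    have h5 := P.cone_smul h4 (r := ε / s) (by positivity)
    rw [add_zero, smul_diagonal_unit, div_mul_cancel₀ _ hs.ne'] at h5
    rw [add_zero]
    exact P.cone_add k _ h5 _ h
  archimedean k M hM := by
    obtain ⟨x, rfl⟩ := exists_rep J M
    rw [mem_quotientCone_mk]
    intro ε hε
    have h := hM (ε / 2) (half_pos hε)
    rw [← diagonal_map_mk, map_mk_add, mem_quotientCone_mk] at h
    obtain ⟨κ, hκ, h⟩ := h (ε / 2) (half_pos hε)
    refine ⟨κ, hκ, ?_⟩
    convert h using 1
    conv_lhs => rw [← add_halves ε, diagonal_add_diagonal]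
    abel

/-- `f` is a complete quotient map: it is completely positive, and the map `P / ker f → Q` induced
by `f` is a complete order isomorphism. -/
def IsCompleteQuotientMap (P : OperatorSystem V) (Q : OperatorSystem W) (f : V →ₗ[ℂ] W) : Prop :=
  P.IsCP Q f ∧ ∃ (hf : IsKernel.{u, v} P (LinearMap.ker f)) (e : (V ⧸ LinearMap.ker f) ≃ₗ[ℂ] W),
    (∀ x : V, e (Submodule.Quotient.mk x) = f x) ∧
      IsCompleteOrderIso (P.quotient (LinearMap.ker f) hf) Q e

end Basic

section Concrete

variable {A : Type u} [CStarAlgebra A] [PartialOrder A] [StarOrderedRing A]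

theorem conjTranspose_mul_self_nonneg {k m : ℕ} (N : CStarMatrix (Fin k) (Fin m) A) :
    0 ≤ N.conjTranspose * N := by
  rcases m with _ | m
  · refine le_of_eq ?_
    ext i
    exact i.elim0
  let Q : Fin k → CStarMatrix (Fin (m + 1)) (Fin (m + 1)) A := fun r =>
    CStarMatrix.ofMatrix (Matrix.of fun i j => if i = 0 then N r j else 0)
  have h : N.conjTranspose * N = ∑ r, star (Q r) * Q r := by
    have hs : ∀ (s : Finset (Fin k)) (f : Fin k → CStarMatrix (Fin (m + 1)) (Fin (m + 1)) A) i j,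
        (∑ r ∈ s, f r) i j = ∑ r ∈ s, f r i j := by
      intro s f i j
      induction s using Finset.cons_induction with
      | empty => simp
      | cons a s ha ih => rw [Finset.sum_cons, Finset.sum_cons, CStarMatrix.add_apply, ih]
    ext i j
    rw [hs, CStarMatrix.mul_apply]
    refine Finset.sum_congr rfl fun r _ => ?_
    rw [CStarMatrix.mul_apply, Finset.sum_eq_single 0]
    · simp [Q, CStarMatrix.star_apply]
    · intro b _ hb
      simp [Q, CStarMatrix.star_apply, hb]
    · simp
  rw [h]
  exact Finset.sum_nonneg fun r _ => star_mul_self_nonneg _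

theorem nonneg_compress {k m : ℕ} (X : Matrix (Fin k) (Fin m) ℂ)
    {M : Matrix (Fin k) (Fin k) A} (hM : 0 ≤ CStarMatrix.ofMatrix M) :
    0 ≤ CStarMatrix.ofMatrix (matrixCompress X M) := by
  let Y : CStarMatrix (Fin k) (Fin m) A :=
    CStarMatrix.ofMatrix (Matrix.of fun i j => algebraMap ℂ A (X i j))
  have key : ∀ N : CStarMatrix (Fin k) (Fin k) A, N ∈ AddSubmonoid.closure
      (Set.range fun B : CStarMatrix (Fin k) (Fin k) A => star B * B) →
      0 ≤ CStarMatrix.ofMatrix (matrixCompress X (CStarMatrix.ofMatrix.symm N)) := by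
    intro N hN
    induction hN using AddSubmonoid.closure_induction with
    | mem N hN =>
      obtain ⟨B, rfl⟩ := hN
      convert conjTranspose_mul_self_nonneg (B * Y) using 1
      ext i j
      have e1 : ∀ c j, (B * Y) c j = ∑ b, X b j • B c b := by
        intro c j
        rw [CStarMatrix.mul_apply]
        refine Finset.sum_congr rfl fun b _ => ?_
        rw [Algebra.smul_def, Algebra.commutes]
        rfl
      rw [CStarMatrix.mul_apply]
      simp only [CStarMatrix.conjTranspose_apply, e1, star_sum, star_smul,
        Finset.sum_mul, Finset.mul_sum]
      simp only [CStarMatrix.ofMatrix_apply, matrixCompress, Matrix.of_apply]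
      have e2 : ∀ a b, (CStarMatrix.ofMatrix.symm (star B * B)) a b =
          ∑ c, star (B c a) * B c b := by
        intro a b
        change (star B * B) a b = _
        rw [CStarMatrix.mul_apply]
        rfl
      simp only [e2, Finset.smul_sum, smul_mul_smul_comm]
      conv_rhs =>
        rw [Finset.sum_comm]
        enter [2, x]
        rw [Finset.sum_comm]
      rw [Finset.sum_comm]
    | zero =>
      refine le_of_eq ?_
      ext i j
      simp [matrixCompress]
    | add M N _ _ hM hN =>
      have e : CStarMatrix.ofMatrix (matrixCompress X (CStarMatrix.ofMatrix.symm (M + N))) =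
          CStarMatrix.ofMatrix (matrixCompress X (CStarMatrix.ofMatrix.symm M)) +
          CStarMatrix.ofMatrix (matrixCompress X (CStarMatrix.ofMatrix.symm N)) :=
        matrixCompress_add X _ _
      rw [e]
      exact add_nonneg hM hN
  exact key _ (StarOrderedRing.nonneg_iff.1 hM)

/-- The concrete operator system given by a unital `*`-closed subspace `S` of a unital
C*-algebra `A`; a matrix over `S` is positive when it is positive in `M_k(A)`. -/
noncomputable def ofSubmodule (S : Submodule ℂ A) (h1 : (1 : A) ∈ S)
    (hstar : ∀ x ∈ S, star x ∈ S) : OperatorSystem S where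
  adj :=
    { toFun := fun x => ⟨star (x : A), hstar x x.2⟩
      map_add' := fun x y => Subtype.ext (by simp)
      map_smul' := fun c x => Subtype.ext (by simp) }
  adj_adj x := Subtype.ext (by simp)
  unit := ⟨1, h1⟩
  cone k := {M | 0 ≤ CStarMatrix.ofMatrix (M.map (Subtype.val : S → A))}
  cone_adj k M hM i j := by
    have h := (IsSelfAdjoint.of_nonneg (Set.mem_ofPred.1 hM)).star_eq
    have h2 := congrFun (congrFun h i) j
    exact Subtype.ext (by simpa [CStarMatrix.star_apply] using h2)
  cone_add k M hM N hN := add_nonneg (Set.mem_ofPred.1 hM) (Set.mem_ofPred.1 hN)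
  cone_compress k m X M hM := by
    have h := nonneg_compress X (Set.mem_ofPred.1 hM)
    have e : matrixCompress X (M.map (Subtype.val : S → A)) =
        (matrixCompress X M).map (Subtype.val : S → A) :=
      matrixCompress_map X M S.subtype
    rwa [e] at h
  cone_proper k M hM hM' := by
    have h : CStarMatrix.ofMatrix (M.map (Subtype.val : S → A)) ≤ 0 := by
      rw [← neg_nonneg]
      exact hM'
    have h2 := le_antisymm h hM
    ext i j
    exact congrFun (congrFun h2 i) j
  exists_unit_add_mem k M hM := by
    let N := CStarMatrix.ofMatrix (M.map (Subtype.val : S → A))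
    have hN : IsSelfAdjoint N := by
      ext i j
      rw [CStarMatrix.star_apply]
      exact congrArg Subtype.val (hM i j)
    refine ⟨‖N‖ + 1, by positivity, ?_⟩
    have h := hN.neg_algebraMap_norm_le_self
    have h2 : (0 : CStarMatrix (Fin k) (Fin k) A) ≤ 1 := zero_le_one
    have h3 : 0 ≤ 1 + (algebraMap ℝ (CStarMatrix (Fin k) (Fin k) A) ‖N‖ + N) :=
      add_nonneg h2 (neg_le_iff_add_nonneg'.1 h)
    rw [Set.mem_ofPred]
    convert h3 using 1
    ext i j
    by_cases hij : i = j
    · subst hij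
      simp [N, Algebra.algebraMap_eq_smul_one, add_smul]
      abel
    · simp [N, Algebra.algebraMap_eq_smul_one, hij]
  archimedean k M hM := by
    let N := CStarMatrix.ofMatrix (M.map (Subtype.val : S → A))
    have hN : ∀ ε : ℝ, 0 < ε → 0 ≤ ε • (1 : CStarMatrix (Fin k) (Fin k) A) + N := by
      intro ε hε
      have h := hM ε hε
      rw [Set.mem_ofPred] at h
      convert h using 1
      ext i j
      by_cases hij : i = j
      · subst hij
        simp [N]
      · simp [N, hij]
    have hlim : Filter.Tendsto (fun ε : ℝ => ε • (1 : CStarMatrix (Fin k) (Fin k) A) + N)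
        (nhdsWithin 0 (Set.Ioi 0)) (nhds N) := by
      have : Filter.Tendsto (fun ε : ℝ => ε • (1 : CStarMatrix (Fin k) (Fin k) A) + N)
          (nhds 0) (nhds ((0 : ℝ) • (1 : CStarMatrix (Fin k) (Fin k) A) + N)) := by
        apply Continuous.tendsto
        fun_prop
      rw [zero_smul, zero_add] at this
      exact this.mono_left nhdsWithin_le_nhds
    exact ge_of_tendsto hlim (Filter.eventually_of_mem self_mem_nhdsWithin fun ε hε => hN ε hε)

end Concrete

end OperatorSystem

/-- The unital C*-algebra `M_{n+1}(ℂ)`, with rows and columns indexed by `0, 1, …, n`. -/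
abbrev MatAlg (n : ℕ) : Type := CStarMatrix (Fin (n + 1)) (Fin (n + 1)) ℂ

/-- The matrix units `E_ij` of `M_{n+1}(ℂ)`. -/
noncomputable def matUnit (n : ℕ) (i j : Fin (n + 1)) : MatAlg n :=
  CStarMatrix.ofMatrix (Matrix.single i j 1)

/-- The subspace `E_n = span {E_00, E_0i, E_i0, ∑ E_ii : 1 ≤ i ≤ n}` of `M_{n+1}(ℂ)`. -/
noncomputable def spaceE (n : ℕ) : Submodule ℂ (MatAlg n) :=
  Submodule.span ℂ ({matUnit n 0 0} ∪ (Set.range fun i : Fin n => matUnit n 0 i.succ) ∪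
    (Set.range fun i : Fin n => matUnit n i.succ 0) ∪
    {∑ i : Fin n, matUnit n i.succ i.succ})

theorem star_matUnit (n : ℕ) (i j : Fin (n + 1)) : star (matUnit n i j) = matUnit n j i := by
  ext a b
  rw [CStarMatrix.star_apply]
  simp only [matUnit, CStarMatrix.ofMatrix_apply, Matrix.single_apply]
  rw [apply_ite star, star_one, star_zero]
  simp only [and_comm]

theorem one_eq_matUnit (n : ℕ) :
    (1 : MatAlg n) = matUnit n 0 0 + ∑ i : Fin n, matUnit n i.succ i.succ := by
  rw [← Fin.sum_univ_succ (fun i => matUnit n i i)]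
  change (1 : Matrix (Fin (n + 1)) (Fin (n + 1)) ℂ) =
    ∑ i, (Matrix.single i i 1 : Matrix (Fin (n + 1)) (Fin (n + 1)) ℂ)
  ext a b
  simp [Matrix.sum_apply, Matrix.single_apply, Matrix.one_apply, ite_and]

theorem one_mem_spaceE (n : ℕ) : (1 : MatAlg n) ∈ spaceE n := by
  rw [one_eq_matUnit]
  exact (spaceE n).add_mem (Submodule.subset_span (by simp)) (Submodule.subset_span (by simp))

theorem star_mem_spaceE (n : ℕ) : ∀ x ∈ spaceE n, star x ∈ spaceE n := by
  intro x hx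
  induction hx using Submodule.span_induction with
  | mem x hx =>
    apply Submodule.subset_span
    rcases hx with ((rfl | ⟨i, rfl⟩) | ⟨i, rfl⟩) | rfl
    · simp [star_matUnit]
    · simp [star_matUnit]
    · simp [star_matUnit]
    · simp [star_matUnit, star_sum]
  | zero => simp
  | add x y _ _ hx hy => rw [star_add]; exact (spaceE n).add_mem hx hy
  | smul c x _ hx => rw [star_smul]; exact (spaceE n).smul_mem _ hx

/-- The operator system `E_n ⊆ M_{n+1}(ℂ)`. -/
noncomputable def systemE (n : ℕ) : OperatorSystem (spaceE n) :=
  OperatorSystem.ofSubmodule (spaceE n) (one_mem_spaceE n) (star_mem_spaceE n)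

/-- The subspace `J = span {E_00 - ∑ E_ii}`, as a subspace of `E_n`. -/
noncomputable def spaceJ (n : ℕ) : Submodule ℂ (spaceE n) :=
  (Submodule.span ℂ {matUnit n 0 0 - ∑ i : Fin n, matUnit n i.succ i.succ}).comap
    (spaceE n).subtype

section Cuntz

variable {A : Type u} [CStarAlgebra A]

/-- `x` is a universal unitary: for each unitary `y` of a unital C*-algebra `B` there is a unital
`*`-homomorphism from the C*-algebra generated by `x` to `B` that sends `x` to `y`. -/
def IsUniversalUnitary (x : A) : Prop :=
  x ∈ unitary A ∧ ∀ (B : Type) [CStarAlgebra B] (y : B), y ∈ unitary B →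
    ∃ π : StarAlgebra.elemental ℂ x →⋆ₐ[ℂ] B,
      π ⟨x, StarAlgebra.elemental.self_mem ℂ x⟩ = y

/-- `S_1, …, S_n` are Cuntz isometries: isometries whose range projections sum to `1`. For `n = 1`,
where this just says that `S_1` is unitary, `S_1` has to be a universal unitary. -/
structure IsCuntzFamily {n : ℕ} (S : Fin n → A) : Prop where
  isometry : ∀ i, star (S i) * S i = 1
  sum_range : ∑ i, S i * star (S i) = 1
  universal : n = 1 → ∀ i, IsUniversalUnitary (S i)

/-- The subspace `S_n = span {1, S_i, S_i* : 1 ≤ i ≤ n}`. -/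
noncomputable def spaceS {n : ℕ} (S : Fin n → A) : Submodule ℂ A :=
  Submodule.span ℂ ({1} ∪ Set.range S ∪ Set.range fun i => star (S i))

theorem one_mem_spaceS {n : ℕ} (S : Fin n → A) : (1 : A) ∈ spaceS S :=
  Submodule.subset_span (by simp)

theorem mem_spaceS {n : ℕ} (S : Fin n → A) (i : Fin n) : S i ∈ spaceS S :=
  Submodule.subset_span (by simp)

theorem star_gen_mem_spaceS {n : ℕ} (S : Fin n → A) (i : Fin n) : star (S i) ∈ spaceS S :=
  Submodule.subset_span (by simp)

theorem star_mem_spaceS {n : ℕ} (S : Fin n → A) : ∀ x ∈ spaceS S, star x ∈ spaceS S := by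
  intro x hx
  induction hx using Submodule.span_induction with
  | mem x hx =>
    rcases hx with (rfl | ⟨i, rfl⟩) | ⟨i, rfl⟩
    · rw [star_one]; exact one_mem_spaceS S
    · exact star_gen_mem_spaceS S i
    · simp only [star_star]; exact mem_spaceS S i
  | zero => simp
  | add x y _ _ hx hy => rw [star_add]; exact (spaceS S).add_mem hx hy
  | smul c x _ hx => rw [star_smul]; exact (spaceS S).smul_mem _ hx

/-- The operator system `S_n` generated by `S_1, …, S_n`. -/
noncomputable def systemS [PartialOrder A] [StarOrderedRing A] {n : ℕ} (S : Fin n → A) :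
    OperatorSystem (spaceS S) :=
  OperatorSystem.ofSubmodule (spaceS S) (one_mem_spaceS S) (star_mem_spaceS S)

/-- The row `R = (√2/2) (1, S_1*, …, S_n*)`. -/
noncomputable def rowR {n : ℕ} (S : Fin n → A) : CStarMatrix Unit (Fin (n + 1)) A :=
  CStarMatrix.ofMatrix (Matrix.of fun _ j =>
    ((Real.sqrt 2 / 2 : ℝ) : ℂ) • (Fin.cons 1 (fun i => star (S i)) : Fin (n + 1) → A) j)

/-- The linear map `ψ : M_{n+1}(ℂ) → A` with `ψ(E_ij) = (R* R)_ij`. -/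
noncomputable def psi {n : ℕ} (S : Fin n → A) : MatAlg n →ₗ[ℂ] A where
  toFun X := ∑ i, ∑ j, X i j • ((rowR S).conjTranspose * rowR S) i j
  map_add' X Y := by simp [add_smul, Finset.sum_add_distrib]
  map_smul' c X := by simp [Finset.smul_sum, smul_smul]

theorem psi_matUnit {n : ℕ} (S : Fin n → A) (i j : Fin (n + 1)) :
    psi S (matUnit n i j) = ((rowR S).conjTranspose * rowR S) i j := by
  change ∑ a, ∑ b, (matUnit n i j) a b • ((rowR S).conjTranspose * rowR S) a b = _
  simp [matUnit, Matrix.single_apply, ite_and]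

theorem rowR_mul {n : ℕ} (S : Fin n → A) (i j : Fin (n + 1)) :
    ((rowR S).conjTranspose * rowR S) i j = (2⁻¹ : ℂ) •
      (star ((Fin.cons 1 (fun i => star (S i)) : Fin (n + 1) → A) i) *
        (Fin.cons 1 (fun i => star (S i)) : Fin (n + 1) → A) j) := by
  have h : ((Real.sqrt 2 / 2 : ℝ) : ℂ) * ((Real.sqrt 2 / 2 : ℝ) : ℂ) = 2⁻¹ := by
    rw [← Complex.ofReal_mul, div_mul_div_comm, Real.mul_self_sqrt zero_le_two]
    norm_num
  rw [CStarMatrix.mul_apply]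
  simp only [Finset.univ_unique, Finset.sum_singleton, CStarMatrix.conjTranspose_apply, rowR,
    CStarMatrix.ofMatrix_apply, Matrix.of_apply, star_smul, Complex.star_def, Complex.conj_ofReal]
  rw [smul_mul_smul_comm, h]

theorem psi_mem_spaceS {n : ℕ} {S : Fin n → A} (hS : IsCuntzFamily S) :
    ∀ x ∈ spaceE n, psi S x ∈ spaceS S := by
  intro x hx
  induction hx using Submodule.span_induction with
  | mem x hx =>
    rcases hx with ((rfl | ⟨i, rfl⟩) | ⟨i, rfl⟩) | rfl
    · rw [psi_matUnit, rowR_mul]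
      exact (spaceS S).smul_mem _ (by simpa using one_mem_spaceS S)
    · rw [psi_matUnit, rowR_mul]
      exact (spaceS S).smul_mem _ (by simpa using star_gen_mem_spaceS S i)
    · rw [psi_matUnit, rowR_mul]
      exact (spaceS S).smul_mem _ (by simpa using mem_spaceS S i)
    · simp only [map_sum, psi_matUnit, rowR_mul, Fin.cons_succ, star_star]
      rw [← Finset.smul_sum, hS.sum_range]
      exact (spaceS S).smul_mem _ (one_mem_spaceS S)
  | zero => simp
  | add x y _ _ hx hy => rw [map_add]; exact (spaceS S).add_mem hx hy
  | smul c x _ hx => rw [map_smul]; exact (spaceS S).smul_mem _ hx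

/-- The restriction `φ : E_n → S_n` of `ψ`. -/
noncomputable def phi {n : ℕ} {S : Fin n → A} (hS : IsCuntzFamily S) :
    spaceE n →ₗ[ℂ] spaceS S :=
  (psi S).restrict (psi_mem_spaceS hS)

end Cuntz

/-! ### Words in the generators, graded by length -/

section Words

/-! A self-adjoint matrix over `S_n` is a pencil `A₀ ⊗ 1 + ∑ aₗ ⊗ Sₗ + ∑ aₗ* ⊗ Sₗ*`. The heart of
the theorem is that a positive pencil lifts, up to `ε`, to a positive matrix over `E_n`
(`exists_lift_mem_cone`). The rest is softer: `ψ` is completely positive because it is given by `R*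
R`, and its kernel on `E_n` is `J` because `1, Sₗ, Sₗ*` are linearly independent.

Up to the factor 2, a lift is a splitting `A₀ = B + C` for which the arrow matrix with corner `B`,
diagonal `C` and arms `aₗ` is positive. For `C > 0` it suffices that `B ≥ ∑ aₗ* C⁻¹ aₗ`, so a fixed
point of `C ↦ A₀ - ∑ aₗ* C⁻¹ aₗ` would do. No limit is taken: the arrows belonging to the iterates
`C₀, …, C_{m-1}` are added up (`exists_arrow_mem_cone`). The sum telescopes to `m A₀ + A₀ - C_m`,
and after division by `m` the boundary term is small enough to be absorbed in `ε`.

This needs every `C_m` of the perturbed pencil to be positive definite. Gaussian elimination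
(`exists_pencil_column`) gives a column `p = ξ + (words)` which the pencil maps to `C_m ξ`, plus
adjoints of generators, plus words of length `m + 1`. A positive map killing nonempty words and
their adjoints therefore sends `p* (pencil) p` to a multiple of `⟨ξ, C_m ξ⟩`. On Fock space this is
the vacuum state. Here only words of bounded length occur, and a substitute for the vacuum exists
for each bound: compression by `S₀ᴺ S₁` if `n ≥ 2`, and an average of characters at roots of unity
if `n = 1`, which is where universality enters. -/

variable {R : Type*} [Ring R] [Algebra ℂ R] {n : ℕ}

/-- The span of the words in `S_1, …, S_n` whose length lies in `[a, b]`. -/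
def wordSpan (S : Fin n → R) (a b : ℕ) : Submodule ℂ R :=
  Submodule.span ℂ {x | ∃ l : List (Fin n), a ≤ l.length ∧ l.length ≤ b ∧ x = (l.map S).prod}

theorem word_mem_wordSpan (S : Fin n → R) {a b : ℕ} (l : List (Fin n)) (ha : a ≤ l.length)
    (hb : l.length ≤ b) : (l.map S).prod ∈ wordSpan S a b :=
  Submodule.subset_span ⟨l, ha, hb, rfl⟩

theorem wordSpan_mono (S : Fin n → R) {a b a' b' : ℕ} (ha : a' ≤ a) (hb : b ≤ b') :
    wordSpan S a b ≤ wordSpan S a' b' := by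
  refine Submodule.span_mono ?_
  rintro x ⟨l, h1, h2, rfl⟩
  exact ⟨l, ha.trans h1, h2.trans hb, rfl⟩

theorem one_mem_wordSpan (S : Fin n → R) (b : ℕ) : (1 : R) ∈ wordSpan S 0 b := by
  simpa using word_mem_wordSpan S (a := 0) (b := b) [] (by simp) (by simp)

theorem gen_mem_wordSpan (S : Fin n → R) (i : Fin n) : S i ∈ wordSpan S 1 1 := by
  simpa using word_mem_wordSpan S (a := 1) (b := 1) [i] (by simp) (by simp)

theorem mul_mem_wordSpan {S : Fin n → R} {a b a' b' : ℕ} {x y : R} (hx : x ∈ wordSpan S a b)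
    (hy : y ∈ wordSpan S a' b') : x * y ∈ wordSpan S (a + a') (b + b') := by
  have h := Submodule.mul_mem_mul hx hy
  rw [wordSpan, wordSpan, Submodule.span_mul_span] at h
  refine Submodule.span_mono ?_ h
  rintro _ ⟨_, ⟨l, h1, h2, rfl⟩, _, ⟨l', h1', h2', rfl⟩, rfl⟩
  exact ⟨l ++ l', by simp; omega, by simp; omega, by simp⟩

variable [StarRing R]

/-- Letters cancel in pairs from the inside, so the product vanishes unless `v` is a prefix of `w`,
and then the remaining suffix is left. -/
theorem star_word_mul_word {S : Fin n → R}
    (horth : ∀ i j, star (S i) * S j = if i = j then 1 else 0) :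
    ∀ (v w : List (Fin n)), v.length ≤ w.length →
      star (v.map S).prod * (w.map S).prod ∈
        wordSpan S (w.length - v.length) (w.length - v.length)
  | [], w, _ => by simpa using word_mem_wordSpan S w le_rfl le_rfl
  | i :: v, [], h => by simp at h
  | i :: v, j :: w, h => by
    simp only [List.map_cons, List.prod_cons, star_mul, List.length_cons, Nat.add_sub_add_right]
    rw [mul_assoc, ← mul_assoc (star (S i)), horth]
    split_ifs
    · rw [one_mul]
      exact star_word_mul_word horth v w (by simpa using h)
    · simp

variable [StarModule ℂ R]

/-- The gap between lengths at most `m` and exactly `m + 1` leaves at least one letter uncancelled.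
Hence a vacuum map annihilates the error term of the elimination. -/
theorem star_mul_mem_wordSpan {S : Fin n → R}
    (horth : ∀ i j, star (S i) * S j = if i = j then 1 else 0) {m : ℕ} {x y : R}
    (hx : x ∈ wordSpan S 0 m) (hy : y ∈ wordSpan S (m + 1) (m + 1)) :
    star x * y ∈ wordSpan S 1 (m + 1) := by
  induction hx using Submodule.span_induction with
  | zero => simp
  | add x x' _ _ h h' => rw [star_add, add_mul]; exact add_mem h h'
  | smul c x _ h => rw [star_smul, smul_mul_assoc]; exact Submodule.smul_mem _ _ h
  | mem x hx =>
    obtain ⟨v, -, hv, rfl⟩ := hx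
    induction hy using Submodule.span_induction with
    | zero => simp
    | add y y' _ _ h h' => rw [mul_add]; exact add_mem h h'
    | smul c y _ h => rw [mul_smul_comm]; exact Submodule.smul_mem _ _ h
    | mem y hy =>
      obtain ⟨w, hw, hw', rfl⟩ := hy
      exact wordSpan_mono S (by omega) (by omega) (star_word_mul_word horth v w (by omega))

end Words

/-! ### Pencils and their iterated Schur complements -/

section Pencil

open Matrix

variable {R : Type*} [Ring R] [Algebra ℂ R] [StarRing R] {n k : ℕ}

/-- The entries of the self-adjoint pencil `A₀ ⊗ 1 + ∑ aₗ ⊗ Sₗ + ∑ aₗ* ⊗ Sₗ*`. -/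
def pencil (S : Fin n → R) (A₀ : Matrix (Fin k) (Fin k) ℂ)
    (a : Fin n → Matrix (Fin k) (Fin k) ℂ) : Matrix (Fin k) (Fin k) R :=
  Matrix.of fun i j => A₀ i j • (1 : R) + ∑ l, a l i j • S l + ∑ l, (a l)ᴴ i j • star (S l)

theorem pencil_add_apply (S : Fin n → R) (A₀ B : Matrix (Fin k) (Fin k) ℂ)
    (a : Fin n → Matrix (Fin k) (Fin k) ℂ) (i j : Fin k) :
    pencil S (A₀ + B) a i j = pencil S A₀ a i j + B i j • (1 : R) := by
  simp only [pencil, Matrix.of_apply, Matrix.add_apply, add_smul]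
  abel

/-- The iterated Schur complements `C₀ = A₀`, `C_{m+1} = A₀ - ∑ aₗ* C_m⁻¹ aₗ`. -/
noncomputable def schurSeq (A₀ : Matrix (Fin k) (Fin k) ℂ)
    (a : Fin n → Matrix (Fin k) (Fin k) ℂ) : ℕ → Matrix (Fin k) (Fin k) ℂ
  | 0 => A₀
  | m + 1 => A₀ - ∑ l, (a l)ᴴ * (schurSeq A₀ a m)⁻¹ * a l

theorem schurSeq_isHermitian {A₀ : Matrix (Fin k) (Fin k) ℂ} (hA : A₀.IsHermitian)
    (a : Fin n → Matrix (Fin k) (Fin k) ℂ) (m : ℕ) : (schurSeq A₀ a m).IsHermitian := by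
  induction m with
  | zero => exact hA
  | succ m ih =>
    refine hA.sub ?_
    rw [Matrix.IsHermitian, Matrix.conjTranspose_sum]
    refine Finset.sum_congr rfl fun l _ => ?_
    rw [Matrix.conjTranspose_mul, Matrix.conjTranspose_mul, Matrix.conjTranspose_conjTranspose,
      Matrix.conjTranspose_nonsing_inv, ih.eq, Matrix.mul_assoc]

/-- Approximate Gaussian elimination for the pencil, up to words of length `m + 1`. -/
theorem exists_pencil_column {S : Fin n → R}
    (horth : ∀ i j, star (S i) * S j = if i = j then 1 else 0)
    (A₀ : Matrix (Fin k) (Fin k) ℂ) (a : Fin n → Matrix (Fin k) (Fin k) ℂ) (m : ℕ)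
    (hunit : ∀ j < m, IsUnit (schurSeq A₀ a j).det) (ξ : Fin k → ℂ) :
    ∃ p r : Fin k → R, (∀ i, p i - ξ i • (1 : R) ∈ wordSpan S 1 m) ∧
      (∀ i, r i ∈ wordSpan S (m + 1) (m + 1)) ∧
      ∀ i, ∑ j, pencil S A₀ a i j * p j = (schurSeq A₀ a m *ᵥ ξ) i • (1 : R) +
        ∑ l, ((a l)ᴴ *ᵥ ξ) i • star (S l) + r i := by
  have hbase : ∀ (ξ : Fin k → ℂ) (i : Fin k), ∑ j, pencil S A₀ a i j * (ξ j • (1 : R)) =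
      (A₀ *ᵥ ξ) i • (1 : R) + ∑ l, (a l *ᵥ ξ) i • S l + ∑ l, ((a l)ᴴ *ᵥ ξ) i • star (S l) := by
    intro ξ i
    simp only [pencil, Matrix.of_apply, mul_smul_comm, mul_one, smul_add, Finset.smul_sum,
      smul_smul, Finset.sum_add_distrib, Matrix.mulVec, dotProduct, Finset.sum_smul]
    rw [Finset.sum_comm (γ := Fin n), Finset.sum_comm (γ := Fin n)]
    simp only [mul_comm (ξ _)]
  induction m generalizing ξ with
  | zero =>
    refine ⟨fun j => ξ j • 1, fun i => ∑ l, (a l *ᵥ ξ) i • S l, fun i => by simp, fun i => ?_,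
      fun i => ?_⟩
    · exact Submodule.sum_mem _ fun l _ => Submodule.smul_mem _ _ (gen_mem_wordSpan S l)
    · rw [hbase, schurSeq]
      abel
  | succ m ih =>
    have ih := fun ξ => ih (fun j hj => hunit j (by omega)) ξ
    choose p r hp hr h using ih
    -- With this `η l`, the column `p (η l) * S l` produces exactly the term `a l ξ ⊗ S l` that has
    -- to be cancelled. Its adjoint part meets `S l` and returns `(a l)ᴴ η l ⊗ 1`, which is the
    -- Schur correction.
    let η : Fin n → Fin k → ℂ := fun l => ((schurSeq A₀ a m)⁻¹ * a l) *ᵥ ξ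
    have hη : ∀ l, schurSeq A₀ a m *ᵥ η l = a l *ᵥ ξ := fun l => by
      rw [Matrix.mulVec_mulVec, Matrix.mul_nonsing_inv_cancel_left _ _ (hunit m (by omega))]
    refine ⟨fun i => ξ i • 1 - ∑ l, p (η l) i * S l, fun i => -∑ l, r (η l) i * S l,
      fun i => ?_, fun i => ?_, fun i => ?_⟩
    · rw [sub_sub_cancel_left]
      refine neg_mem (Submodule.sum_mem _ fun l _ => ?_)
      have h1 : p (η l) i ∈ wordSpan S 0 m := by
        have := add_mem (wordSpan_mono S (Nat.zero_le 1) le_rfl (hp (η l) i))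
          (Submodule.smul_mem _ (η l i) (one_mem_wordSpan S m))
        simpa using this
      exact wordSpan_mono S (by omega) le_rfl (mul_mem_wordSpan h1 (gen_mem_wordSpan S l))
    · exact neg_mem (Submodule.sum_mem _ fun l _ =>
        mul_mem_wordSpan (hr (η l) i) (gen_mem_wordSpan S l))
    · have e : ∀ l, ∑ j, pencil S A₀ a i j * (p (η l) j * S l) =
          (a l *ᵥ ξ) i • S l + ((a l)ᴴ *ᵥ η l) i • (1 : R) + r (η l) i * S l := by
        intro l
        simp only [← mul_assoc]
        rw [← Finset.sum_mul, h, hη, add_mul, add_mul, smul_mul_assoc, one_mul, Finset.sum_mul]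
        congr 2
        simp [horth]
      simp only [mul_sub, Finset.sum_sub_distrib, hbase, Finset.mul_sum]
      rw [Finset.sum_comm]
      simp only [e, Finset.sum_add_distrib]
      have e2 : (schurSeq A₀ a (m + 1) *ᵥ ξ) i • (1 : R) =
          (A₀ *ᵥ ξ) i • (1 : R) - ∑ l, ((a l)ᴴ *ᵥ η l) i • (1 : R) := by
        rw [schurSeq, Matrix.sub_mulVec, Matrix.sum_mulVec, Pi.sub_apply, Finset.sum_apply, sub_smul,
          Finset.sum_smul]
        simp only [η, Matrix.mulVec_mulVec, Matrix.mul_assoc]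
      rw [e2]
      abel

end Pencil

/-! ### Lower bound for the Schur complements -/

section LowerBound

open Matrix

variable {A : Type*} [CStarAlgebra A] [PartialOrder A] [StarOrderedRing A]

theorem nonneg_of_smul_nonneg {e : A} (he : 0 ≤ e) (he' : e ≠ 0) {c : ℂ} (h : 0 ≤ c • e) :
    0 ≤ c := by
  have h1 : star c = c := by
    have h2 := (IsSelfAdjoint.of_nonneg h).star_eq
    rw [star_smul, (IsSelfAdjoint.of_nonneg he).star_eq] at h2
    exact smul_left_injective ℂ he' h2
  obtain ⟨r, rfl⟩ := Complex.conj_eq_iff_real.1 h1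
  by_contra hr
  rw [Complex.zero_le_real, not_le] at hr
  have h2 : 0 ≤ ((-r : ℝ) : ℂ) • e :=
    smul_nonneg (Complex.zero_le_real.2 (neg_nonneg.2 hr.le)) he
  rw [Complex.ofReal_neg, neg_smul, neg_nonneg] at h2
  exact smul_ne_zero (Complex.ofReal_ne_zero.2 hr.ne) he' (le_antisymm h2 h)

variable {R : Type*} [Ring R] [Algebra ℂ R] [StarRing R] [StarModule ℂ R] {n k : ℕ}

/-- For the column `p = ξ + q` of the elimination, `Θ` turns `p* (pencil + ε) p` into `⟨ξ, C ξ⟩ Θ 1`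
and `p* p` into `⟨ξ, ξ⟩ Θ 1 + Θ (q* q)`. Subtracting leaves `⟨ξ, (C - ε) ξ⟩ Θ 1 = Θ (p* (pencil) p +
ε q* q)`. Positivity is assumed for the whole expression because `R` carries no order. -/
theorem posSemidef_schurSeq_sub {S : Fin n → R}
    (horth : ∀ i j, star (S i) * S j = if i = j then 1 else 0)
    {A₀ : Matrix (Fin k) (Fin k) ℂ} (hA : A₀.IsHermitian) (a : Fin n → Matrix (Fin k) (Fin k) ℂ)
    {m : ℕ} {ε : ℝ}
    (hunit : ∀ j < m, IsUnit (schurSeq (A₀ + (ε : ℂ) • 1) a j).det)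
    (Θ : R →ₗ[ℂ] A) (h1 : 0 ≤ Θ 1) (h1' : Θ 1 ≠ 0)
    (hw : ∀ x ∈ wordSpan S 1 (m + 1), Θ x = 0) (hw' : ∀ x ∈ wordSpan S 1 (m + 1), Θ (star x) = 0)
    (hpos : ∀ p q : Fin k → R, 0 ≤ Θ (∑ i, star (p i) * ∑ j, pencil S A₀ a i j * p j +
      (ε : ℂ) • ∑ i, star (q i) * q i)) :
    (schurSeq (A₀ + (ε : ℂ) • 1) a m - (ε : ℂ) • 1).PosSemidef := by
  have hε : ((ε : ℂ) • (1 : Matrix (Fin k) (Fin k) ℂ)).IsHermitian := by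
    rw [Matrix.IsHermitian, Matrix.conjTranspose_smul, Matrix.conjTranspose_one, Complex.star_def,
      Complex.conj_ofReal]
  rw [Matrix.posSemidef_iff_dotProduct_mulVec]
  refine ⟨(schurSeq_isHermitian (hA.add hε) a m).sub hε, fun ξ => ?_⟩
  obtain ⟨p, r, hp, hr, h⟩ := exists_pencil_column horth (A₀ + (ε : ℂ) • 1) a m hunit ξ
  set C := schurSeq (A₀ + (ε : ℂ) • 1) a m
  let q : Fin k → R := fun i => p i - ξ i • 1
  have hq : ∀ i, p i = ξ i • 1 + q i := fun i => by simp [q]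
  have hp0 : ∀ i, p i ∈ wordSpan S 0 m := fun i => by
    rw [hq]
    exact add_mem (Submodule.smul_mem _ _ (one_mem_wordSpan S m))
      (wordSpan_mono S (Nat.zero_le 1) le_rfl (hp i))
  have hΘq : ∀ i, Θ (q i) = 0 := fun i => hw _ (wordSpan_mono S le_rfl (by omega) (hp i))
  have hΘq' : ∀ i, Θ (star (q i)) = 0 := fun i => hw' _ (wordSpan_mono S le_rfl (by omega) (hp i))
  have e1 : ∀ i, Θ (star (p i) * ∑ j, pencil S (A₀ + (ε : ℂ) • 1) a i j * p j) =
      (star (ξ i) * (C *ᵥ ξ) i) • Θ 1 := by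
    intro i
    rw [h, mul_add, mul_add, Finset.mul_sum, map_add, map_add, map_sum,
      hw _ (star_mul_mem_wordSpan horth (hp0 i) (hr i)), add_zero, Finset.sum_eq_zero, add_zero]
    · rw [mul_smul_comm, mul_one, map_smul, hq, star_add, map_add, hΘq', add_zero, star_smul,
        star_one, map_smul, smul_smul, mul_comm]
    -- The factor `star (p i) * star (S l)` is the adjoint of a combination of words of length
    -- between `1` and `m + 1`.
    · intro l _
      rw [mul_smul_comm, ← star_mul, map_smul, hw', smul_zero]
      have := mul_mem_wordSpan (gen_mem_wordSpan S l) (hp0 i)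
      rwa [add_comm 1 m] at this
  have e2 : ∀ i, Θ (star (p i) * p i) = (star (ξ i) * ξ i) • Θ 1 + Θ (star (q i) * q i) := by
    intro i
    have : star (p i) * p i = (star (ξ i) * ξ i) • 1 + star (ξ i) • q i + ξ i • star (q i) +
        star (q i) * q i := by
      rw [hq, star_add, star_smul, star_one, add_mul, mul_add, mul_add]
      simp only [one_mul, mul_one, smul_mul_assoc, mul_smul_comm, mul_comm (star (ξ i)), mul_smul]
      abel
    rw [this]
    simp [hΘq, hΘq']
  have e3 := hpos p q
  refine nonneg_of_smul_nonneg h1 h1' ?_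
  convert e3 using 1
  have e4 : ∀ i, ∑ j, pencil S (A₀ + (ε : ℂ) • 1) a i j * p j =
      ∑ j, pencil S A₀ a i j * p j + (ε : ℂ) • p i := by
    intro i
    simp only [pencil_add_apply, add_mul, Finset.sum_add_distrib]
    congr 1
    simp [Matrix.one_apply]
  have e5 : ∀ i, Θ (star (p i) * ∑ j, pencil S A₀ a i j * p j) =
      (star (ξ i) * (C *ᵥ ξ) i) • Θ 1 - (ε : ℂ) • Θ (star (p i) * p i) := by
    intro i
    rw [← e1, e4, mul_add, map_add, mul_smul_comm, map_smul, add_sub_cancel_right]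
  rw [map_add, map_sum, map_smul, map_sum]
  simp only [e5, e2, smul_add, Finset.sum_sub_distrib, Finset.sum_add_distrib, ← Finset.smul_sum]
  rw [Matrix.sub_mulVec, dotProduct_sub, Matrix.smul_mulVec, Matrix.one_mulVec, dotProduct_smul,
    sub_smul, smul_eq_mul, mul_smul]
  simp only [dotProduct, Finset.sum_smul, Pi.star_apply]
  abel

end LowerBound

/-! ### Orthogonality and substitutes for the vacuum state -/

section Vacuum

variable {A : Type u} [CStarAlgebra A] {n : ℕ}

/-- Conjugating `∑ Sₗ Sₗ* = 1` by `S j` writes `1` as a sum of positive terms whose `j`-th term is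
already `1`, so the others vanish. -/
theorem IsCuntzFamily.star_gen_mul_gen [PartialOrder A] [StarOrderedRing A] {S : Fin n → A}
    (hS : IsCuntzFamily S) (i j : Fin n) :
    star (S i) * S j = if i = j then 1 else 0 := by
  have h : ∑ l, star (star (S l) * S j) * (star (S l) * S j) = 1 := by
    calc _ = star (S j) * (∑ l, S l * star (S l)) * S j := by
          simp only [Finset.mul_sum, Finset.sum_mul, star_mul, star_star, mul_assoc]
      _ = 1 := by rw [hS.sum_range, mul_one, hS.isometry]
  split_ifs with hij
  · rw [hij, hS.isometry]
  · rw [← Finset.add_sum_erase _ _ (Finset.mem_univ j), hS.isometry, star_one, one_mul,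
      add_eq_left, Finset.sum_eq_zero_iff_of_nonneg fun l _ => star_mul_self_nonneg _] at h
    exact (CStarRing.star_mul_self_eq_zero_iff _).1 (h i (by simp [hij]))

/-- A positive map, defined on a star subalgebra that contains `S_1, …, S_n`, which vanishes on the
words in `S_1, …, S_n` of length `1, …, N` and on their adjoints. -/
structure VacuumMap [PartialOrder A] (S : Fin n → A) (N : ℕ) where
  /-- the domain -/
  domain : StarSubalgebra ℂ A
  mem_domain : ∀ i, S i ∈ domain
  /-- the underlying linear map -/
  toLin : domain →ₗ[ℂ] A
  nonneg : ∀ x : domain, 0 ≤ (x : A) → 0 ≤ toLin x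
  map_one_ne : toLin 1 ≠ 0
  map_word : ∀ x ∈ wordSpan (fun i => (⟨S i, mem_domain i⟩ : domain)) 1 N, toLin x = 0
  map_star_word : ∀ x ∈ wordSpan (fun i => (⟨S i, mem_domain i⟩ : domain)) 1 N, toLin (star x) = 0

theorem star_pow_mul_word {R : Type*} [Ring R] [StarRing R] {S : Fin n → R}
    (horth : ∀ i j, star (S i) * S j = if i = j then 1 else 0) (i : Fin n) :
    ∀ (l : List (Fin n)) (N : ℕ), l.length ≤ N →
      star (S i ^ N) * (l.map S).prod = 0 ∨
        star (S i ^ N) * (l.map S).prod = star (S i ^ (N - l.length))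
  | [], N, _ => by simp
  | j :: l, 0, h => by simp at h
  | j :: l, N + 1, h => by
    rw [List.map_cons, List.prod_cons, pow_succ', star_mul, mul_assoc, ← mul_assoc (star (S i)),
      horth, List.length_cons, Nat.add_sub_add_right]
    split_ifs
    · rw [one_mul]
      exact star_pow_mul_word horth i l N (by simpa using h)
    · simp

theorem star_pow_mul_pow {R : Type*} [Ring R] [StarRing R] {s : R} (h : star s * s = 1) (a b : ℕ) :
    star (s ^ a) * s ^ (a + b) = s ^ b := by
  induction a with
  | zero => simp
  | succ a ih =>
    rw [pow_succ', star_mul, Nat.add_right_comm, pow_succ' s (a + b), mul_assoc,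
      ← mul_assoc (star s), h, one_mul, ih]

/-- Compression by the isometry `T = S₀ᴺ S₁`. A word `w` with `1 ≤ |w| ≤ N` survives `S₀ᴺ*` only if
it is a power of `S₀`; then `T* w T = S₁* S₀^|w| S₁ = 0`. -/
theorem exists_vacuumMap_of_two_le [PartialOrder A] [StarOrderedRing A] [Nontrivial A]
    {S : Fin n → A} (hS : IsCuntzFamily S) (hn : 2 ≤ n) (N : ℕ) : Nonempty (VacuumMap S N) := by
  obtain ⟨n, rfl⟩ := Nat.exists_eq_add_of_le' hn
  let T : A := S 0 ^ N * S 1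
  let Θ : A →ₗ[ℂ] A := (LinearMap.mulLeft ℂ (star T)).comp (LinearMap.mulRight ℂ T)
  have hΘ : ∀ x, Θ x = star T * (x * T) := fun x => rfl
  let s : Fin (n + 2) → (⊤ : StarSubalgebra ℂ A) := fun i => ⟨S i, StarSubalgebra.mem_top⟩
  have hword : ∀ x ∈ wordSpan s 1 N, Θ x = 0 := by
    intro x hx
    induction hx using Submodule.span_induction with
    | zero => simp
    | add x y _ _ hx hy => rw [AddMemClass.coe_add, map_add, hx, hy, add_zero]
    | smul c x _ hx => rw [SetLike.val_smul, map_smul, hx, smul_zero]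
    | mem x hx =>
      obtain ⟨l, h1, h2, rfl⟩ := hx
      have e : (((l.map s).prod : (⊤ : StarSubalgebra ℂ A)) : A) = (l.map S).prod := by
        have := map_list_prod (StarSubalgebra.subtype (⊤ : StarSubalgebra ℂ A)) (l.map s)
        rw [List.map_map] at this
        exact this
      rw [e, hΘ]
      simp only [T, star_mul]
      have e2 : star (S 1) * star (S 0 ^ N) * ((l.map S).prod * (S 0 ^ N * S 1)) =
          star (S 1) * (star (S 0 ^ N) * (l.map S).prod) * S 0 ^ N * S 1 := by
        simp only [mul_assoc]
      rw [e2]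
      rcases star_pow_mul_word hS.star_gen_mul_gen 0 l N h2 with h | h
      · rw [h, mul_zero, zero_mul, zero_mul]
      · rw [h]
        have h3 := star_pow_mul_pow (hS.isometry 0) (N - l.length) l.length
        rw [Nat.sub_add_cancel h2] at h3
        rw [mul_assoc (star (S 1)), h3]
        obtain ⟨d, hd⟩ := Nat.exists_eq_add_of_le' h1
        rw [hd, pow_succ', ← mul_assoc, hS.star_gen_mul_gen, if_neg (by simp)]
        simp
  refine ⟨⟨⊤, fun _ => StarSubalgebra.mem_top, Θ.comp (⊤ : StarSubalgebra ℂ A).subtype.toLinearMap,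
    fun x hx => ?_, ?_, hword, fun x hx => ?_⟩⟩
  · change 0 ≤ star T * (x * T)
    rw [← mul_assoc]
    exact star_left_conjugate_nonneg hx T
  · change star T * (1 * T) ≠ 0
    have h3 := star_pow_mul_pow (hS.isometry 0) N 0
    rw [add_zero, pow_zero] at h3
    have : star T * T = 1 := by
      simp only [T, star_mul]
      rw [mul_assoc, ← mul_assoc (star (S 0 ^ N)), h3, one_mul, hS.isometry]
    rw [one_mul, this]
    exact one_ne_zero
  · have h := congrArg star (hword x hx)
    rw [hΘ] at h
    change star T * (star (x : A) * T) = 0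
    simpa [mul_assoc] using h

/-- Universality gives a character of `C*(x)` at each point of the circle. Summing over the `(N +
1)`-th roots of unity kills `x ^ d` for `1 ≤ d ≤ N`. These characters live only on `C*(x)`, hence
the domain in `VacuumMap`. -/
theorem exists_vacuumMap_of_universal [PartialOrder A] [StarOrderedRing A] [Nontrivial A] {x : A}
    (hx : IsUniversalUnitary x) {S : Fin 1 → A} (hS : ∀ i, S i = x) (N : ℕ) :
    Nonempty (VacuumMap S N) := by
  let D := StarAlgebra.elemental ℂ x
  have hmem : ∀ i, S i ∈ D := fun i => by rw [hS]; exact StarAlgebra.elemental.self_mem ℂ x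
  let X : D := ⟨x, StarAlgebra.elemental.self_mem ℂ x⟩
  have hex : ∀ z : ℂ, z ∈ unitary ℂ → ∃ π : D →⋆ₐ[ℂ] ℂ, π X = z := fun z hz => hx.2 ℂ z hz
  let ζ : ℂ := Complex.exp (2 * Real.pi * Complex.I / ((N + 1 : ℕ) : ℂ))
  have hζ : IsPrimitiveRoot ζ (N + 1) := Complex.isPrimitiveRoot_exp _ (by omega)
  have hζu : ∀ j : ℕ, ζ ^ j ∈ unitary ℂ := fun j => by
    refine pow_mem ?_ j
    have h1 : ‖ζ‖ = 1 := hζ.norm'_eq_one (by omega)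
    rw [Unitary.mem_iff_star_mul_self, Complex.star_def, Complex.conj_mul', h1]
    simp
  choose π hπ using fun j : ℕ => hex (ζ ^ j) (hζu j)
  let ω : D →ₗ[ℂ] ℂ := ∑ j ∈ Finset.range (N + 1), (π j).toAlgHom.toLinearMap
  have hω : ∀ d, ω d = ∑ j ∈ Finset.range (N + 1), π j d := fun d => by
    simp [ω, LinearMap.sum_apply]
  have hω1 : ω 1 = N + 1 := by simp [hω]
  have hωstar : ∀ d, ω (star d) = star (ω d) := fun d => by simp [hω, map_star]
  have hpos : ∀ (j : ℕ) (d : D), 0 ≤ (d : A) → 0 ≤ π j d := by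
    intro j d hd
    have h1 := AlgHom.apply_mem_spectrum (π j).toAlgHom d
    -- Spectral permanence: positivity is given in `A`, while the character sees the spectrum in the
    -- subalgebra.
    rw [StarSubalgebra.spectrum_eq (hS := StarAlgebra.elemental.isClosed ℂ x)] at h1
    exact spectrum_nonneg_of_nonneg hd h1
  have hword : ∀ d ∈ wordSpan (fun i => (⟨S i, hmem i⟩ : D)) 1 N, ω d = 0 := by
    intro d hd
    induction hd using Submodule.span_induction with
    | zero => simp
    | add x y _ _ hx hy => rw [map_add, hx, hy, add_zero]
    | smul c x _ hx => rw [map_smul, hx, smul_zero]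
    | mem d hd =>
      obtain ⟨l, h1, h2, rfl⟩ := hd
      have e : (l.map fun i => (⟨S i, hmem i⟩ : D)).prod = X ^ l.length := by
        rw [List.prod_eq_pow_card _ X (by simp [X, hS]), List.length_map]
      rw [e, hω]
      simp only [map_pow, hπ, ← pow_mul]
      simp only [mul_comm _ l.length]
      simp only [pow_mul]
      have h3 : ζ ^ l.length ≠ 1 := hζ.pow_ne_one_of_pos_of_lt (by omega) (by omega)
      have h4 := geom_sum_mul_neg (ζ ^ l.length) (N + 1)
      rw [← pow_mul, mul_comm l.length, pow_mul, hζ.pow_eq_one, one_pow, sub_self] at h4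
      exact (mul_eq_zero.1 h4).resolve_right (sub_ne_zero.2 h3.symm)
  refine ⟨⟨D, hmem, (LinearMap.toSpanSingleton ℂ A 1).comp ω, fun d hd => ?_, ?_, fun d hd => ?_,
    fun d hd => ?_⟩⟩
  · rw [LinearMap.comp_apply, LinearMap.toSpanSingleton_apply]
    refine smul_nonneg ?_ zero_le_one
    rw [hω]
    exact Finset.sum_nonneg fun j _ => hpos j d hd
  · rw [LinearMap.comp_apply, LinearMap.toSpanSingleton_apply, hω1]
    exact smul_ne_zero (Nat.cast_add_one_ne_zero N) one_ne_zero
  · rw [LinearMap.comp_apply, hword d hd, map_zero]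
  · rw [LinearMap.comp_apply, hωstar, hword d hd, star_zero, map_zero]

theorem IsCuntzFamily.exists_vacuumMap [PartialOrder A] [StarOrderedRing A] [Nontrivial A]
    {S : Fin n → A} (hS : IsCuntzFamily S) (hn : 1 ≤ n) (N : ℕ) : Nonempty (VacuumMap S N) := by
  rcases hn.eq_or_lt with rfl | hn
  · exact exists_vacuumMap_of_universal (hS.universal rfl 0)
      (fun i => congrArg S (Subsingleton.elim i 0)) N
  · exact exists_vacuumMap_of_two_le hS hn N

end Vacuum

/-! ### Generators of `E_n` and positive arrow matrices -/

section Generators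

open Matrix

theorem matUnit_mul_matUnit (n : ℕ) (i j k l : Fin (n + 1)) :
    matUnit n i j * matUnit n k l = if j = k then matUnit n i l else 0 := by
  ext a b
  rw [CStarMatrix.mul_apply]
  split_ifs with h
  · subst h
    simp only [matUnit, CStarMatrix.ofMatrix_apply, Matrix.single_apply, mul_ite, mul_one, mul_zero,
      ite_and, Finset.sum_ite_eq, Finset.mem_univ, if_true]
    grind
  · simp only [matUnit, CStarMatrix.ofMatrix_apply, Matrix.single_apply, CStarMatrix.zero_apply]
    refine Finset.sum_eq_zero fun c _ => ?_
    grind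

/-- The generator `E_00` of `E_n`. -/
noncomputable def genCorner (n : ℕ) : spaceE n :=
  ⟨matUnit n 0 0, Submodule.subset_span (by simp)⟩

/-- The generators `E_0i` of `E_n`. -/
noncomputable def genRow {n : ℕ} (i : Fin n) : spaceE n :=
  ⟨matUnit n 0 i.succ, Submodule.subset_span (by simp)⟩

/-- The generators `E_i0` of `E_n`. -/
noncomputable def genCol {n : ℕ} (i : Fin n) : spaceE n :=
  ⟨matUnit n i.succ 0, Submodule.subset_span (by simp)⟩

/-- The generator `∑ E_jj` of `E_n`. -/
noncomputable def genDiag (n : ℕ) : spaceE n :=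
  ⟨∑ i : Fin n, matUnit n i.succ i.succ, Submodule.subset_span (by simp)⟩

variable {A : Type u} [CStarAlgebra A] {n k : ℕ} {S : Fin n → A}

theorem phi_genCorner (hS : IsCuntzFamily S) :
    (phi hS (genCorner n) : A) = (2⁻¹ : ℂ) • (1 : A) := by
  change psi S (matUnit n 0 0) = _
  simp [psi_matUnit, rowR_mul]

theorem phi_genRow (hS : IsCuntzFamily S) (i : Fin n) :
    (phi hS (genRow i) : A) = (2⁻¹ : ℂ) • star (S i) := by
  change psi S (matUnit n 0 i.succ) = _
  simp [psi_matUnit, rowR_mul]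

theorem phi_genCol (hS : IsCuntzFamily S) (i : Fin n) :
    (phi hS (genCol i) : A) = (2⁻¹ : ℂ) • S i := by
  change psi S (matUnit n i.succ 0) = _
  simp [psi_matUnit, rowR_mul]

theorem phi_genDiag (hS : IsCuntzFamily S) :
    (phi hS (genDiag n) : A) = (2⁻¹ : ℂ) • (1 : A) := by
  change psi S (∑ i : Fin n, matUnit n i.succ i.succ) = _
  simp only [map_sum, psi_matUnit, rowR_mul, Fin.cons_succ, star_star]
  rw [← Finset.smul_sum, hS.sum_range]

theorem psi_one (hS : IsCuntzFamily S) : psi S 1 = 1 := by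
  have h := congrArg₂ (· + ·) (phi_genCorner hS) (phi_genDiag hS)
  rw [one_eq_matUnit, map_add]
  refine h.trans ?_
  rw [← add_smul]
  norm_num

/-- The element `B ⊗ E_00 + ∑ aₗ ⊗ E_l0 + ∑ aₗ* ⊗ E_0l + C ⊗ ∑ E_ll` of `M_k(E_n)`. -/
noncomputable def arrow (B C : Matrix (Fin k) (Fin k) ℂ) (a : Fin n → Matrix (Fin k) (Fin k) ℂ) :
    Matrix (Fin k) (Fin k) (spaceE n) :=
  Matrix.of fun i j => B i j • genCorner n + ∑ l, a l i j • genCol l +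
    ∑ l, (a l)ᴴ i j • genRow l + C i j • genDiag n

theorem arrow_add (B C B' C' : Matrix (Fin k) (Fin k) ℂ)
    (a a' : Fin n → Matrix (Fin k) (Fin k) ℂ) :
    arrow B C a + arrow B' C' a' = arrow (B + B') (C + C') (a + a') := by
  ext1 i j
  simp only [arrow, Matrix.add_apply, Matrix.of_apply, Pi.add_apply, add_smul,
    Matrix.conjTranspose_add, Finset.sum_add_distrib]
  abel

theorem arrow_map_phi (hS : IsCuntzFamily S) (B C : Matrix (Fin k) (Fin k) ℂ)
    (a : Fin n → Matrix (Fin k) (Fin k) ℂ) (i j : Fin k) :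
    (phi hS (arrow B C a i j) : A) = (2⁻¹ : ℂ) • pencil S (B + C) a i j := by
  simp only [arrow, pencil, Matrix.of_apply, map_add, map_sum, map_smul, Submodule.coe_add,
    Submodule.coe_sum, Submodule.coe_smul, phi_genCorner, phi_genRow, phi_genCol, phi_genDiag,
    smul_add, Finset.smul_sum, Matrix.add_apply, add_smul, smul_comm _ (2⁻¹ : ℂ)]
  abel

theorem CStarMatrix.sum_entry {V ι m : Type*} [AddCommMonoid V] (s : Finset ι)
    (f : ι → CStarMatrix m m V) (i j : m) : (∑ r ∈ s, f r) i j = ∑ r ∈ s, f r i j := by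
  induction s using Finset.cons_induction with
  | empty => simp
  | cons a s ha ih => rw [Finset.sum_cons, Finset.sum_cons, CStarMatrix.add_apply, ih]

/-- The matrix is `N₀* N₀ + ∑ Nₗ* Nₗ` with `N₀ = Z ⊗ E_00` and `Nₗ = X_l ⊗ E_00 + Y ⊗ E_0l`. All
`Nₗ` share the same `Y`, so the diagonal part is a multiple of `∑ E_ll`. -/
theorem arrow_mem_cone (Z Y : Matrix (Fin k) (Fin k) ℂ) (X : Fin n → Matrix (Fin k) (Fin k) ℂ) :
    arrow (Zᴴ * Z + ∑ l, (X l)ᴴ * X l) (Yᴴ * Y) (fun l => Yᴴ * X l) ∈ (systemE n).cone k := by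
  let N : Fin n → CStarMatrix (Fin k) (Fin k) (MatAlg n) := fun l =>
    CStarMatrix.ofMatrix (Matrix.of fun i j => X l i j • matUnit n 0 0 + Y i j • matUnit n 0 l.succ)
  let N₀ : CStarMatrix (Fin k) (Fin k) (MatAlg n) :=
    CStarMatrix.ofMatrix (Matrix.of fun i j => Z i j • matUnit n 0 0)
  change (0 : CStarMatrix (Fin k) (Fin k) (MatAlg n)) ≤ CStarMatrix.ofMatrix (Matrix.map _ _)
  have h : 0 ≤ star N₀ * N₀ + ∑ l, star (N l) * N l :=
    add_nonneg (star_mul_self_nonneg _) (Finset.sum_nonneg fun l _ => star_mul_self_nonneg _)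
  convert h using 1
  ext1 i j
  have e : ∀ P Q : Matrix (Fin k) (Fin k) ℂ, ∀ i j, (Pᴴ * Q) i j = ∑ c, star (P c i) * Q c j :=
    fun P Q i j => rfl
  have e' : ∀ l, (Yᴴ * X l)ᴴ = (X l)ᴴ * Y := fun l => by
    rw [Matrix.conjTranspose_mul, Matrix.conjTranspose_conjTranspose]
  simp only [CStarMatrix.add_apply, CStarMatrix.sum_entry, CStarMatrix.mul_apply,
    CStarMatrix.star_apply, N, N₀, CStarMatrix.ofMatrix_apply, Matrix.of_apply, Matrix.map_apply,
    star_add, star_smul, star_matUnit, add_mul, mul_add, smul_mul_smul_comm, matUnit_mul_matUnit,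
    if_true, Finset.sum_add_distrib, arrow, Submodule.coe_add, Submodule.coe_sum,
    Submodule.coe_smul, e', Matrix.add_apply, Matrix.sum_apply, e, add_smul, Finset.sum_smul,
    genCorner, genRow, genCol, genDiag, Finset.smul_sum]
  rw [Finset.sum_comm (s := Finset.univ (α := Fin k)) (t := Finset.univ (α := Fin n))]
  abel

/-- The extremal case of the Schur complement criterion: with `C⁻¹ = L* L`, take `Y = L C` and `X_l
= L a_l`. -/
theorem arrow_mem_cone_of_posDef {C : Matrix (Fin k) (Fin k) ℂ} (hC : C.PosDef)
    (a : Fin n → Matrix (Fin k) (Fin k) ℂ) :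
    arrow (∑ l, (a l)ᴴ * C⁻¹ * a l) C a ∈ (systemE n).cone k := by
  obtain ⟨L, hL⟩ : ∃ L : Matrix (Fin k) (Fin k) ℂ, C⁻¹ = Lᴴ * L := by
    open scoped MatrixOrder in
    exact CStarAlgebra.nonneg_iff_eq_star_mul_self.1 hC.inv.posSemidef.nonneg
  have hu : IsUnit C.det := (Matrix.isUnit_iff_isUnit_det C).1 hC.isUnit
  have h := arrow_mem_cone (n := n) 0 (L * C) fun l => L * a l
  have e1 : (L * C)ᴴ * (L * C) = C := by
    rw [Matrix.conjTranspose_mul, hC.isHermitian.eq, Matrix.mul_assoc, ← Matrix.mul_assoc Lᴴ, ← hL,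
      Matrix.nonsing_inv_mul _ hu, Matrix.mul_one]
  have e2 : ∀ l, (L * C)ᴴ * (L * a l) = a l := fun l => by
    rw [Matrix.conjTranspose_mul, hC.isHermitian.eq, Matrix.mul_assoc, ← Matrix.mul_assoc Lᴴ, ← hL,
      Matrix.mul_nonsing_inv_cancel_left _ _ hu]
  have e3 : ∀ l, (L * a l)ᴴ * (L * a l) = (a l)ᴴ * C⁻¹ * a l := fun l => by
    rw [Matrix.conjTranspose_mul, hL]
    simp only [Matrix.mul_assoc]
  simpa only [e1, e2, e3, Matrix.conjTranspose_zero, Matrix.mul_zero, zero_add] using h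

theorem arrow_mem_cone_of_posSemidef {F : Matrix (Fin k) (Fin k) ℂ} (hF : F.PosSemidef) :
    arrow F 0 (0 : Fin n → Matrix (Fin k) (Fin k) ℂ) ∈ (systemE n).cone k := by
  obtain ⟨L, rfl⟩ : ∃ L : Matrix (Fin k) (Fin k) ℂ, F = Lᴴ * L := by
    open scoped MatrixOrder in
    exact CStarAlgebra.nonneg_iff_eq_star_mul_self.1 hF.nonneg
  have h := arrow_mem_cone (n := n) L 0 0
  simpa [← Pi.zero_def] using h

/-- Add the extremal arrows for `C₀, …, C_{m-1}`. The `j`-th has corner plus diagonal equal to `(A₀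
- C_{j+1}) + C_j`, so the sum telescopes. -/
theorem exists_arrow_mem_cone {A₀ : Matrix (Fin k) (Fin k) ℂ}
    {a : Fin n → Matrix (Fin k) (Fin k) ℂ} (h : ∀ m, (schurSeq A₀ a m).PosDef) (m : ℕ) :
    ∃ B C : Matrix (Fin k) (Fin k) ℂ, arrow B C (m • a) ∈ (systemE n).cone k ∧
      B + C = m • A₀ + A₀ - schurSeq A₀ a m := by
  induction m with
  | zero =>
    refine ⟨0, 0, ?_, by simp [schurSeq]⟩
    rw [zero_smul]
    exact arrow_mem_cone_of_posSemidef Matrix.PosSemidef.zero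
  | succ m ih =>
    obtain ⟨B, C, h1, h2⟩ := ih
    have h3 := (systemE n).cone_add k _ h1 _ (arrow_mem_cone_of_posDef (h m) a)
    rw [arrow_add, ← succ_nsmul] at h3
    refine ⟨_, _, h3, ?_⟩
    rw [add_add_add_comm, h2, schurSeq, succ_nsmul]
    abel

theorem exists_posSemidef_smul_one_sub {C : Matrix (Fin k) (Fin k) ℂ} (hC : C.IsHermitian) :
    ∃ r : ℝ, ((r : ℂ) • (1 : Matrix (Fin k) (Fin k) ℂ) - C).PosSemidef := by
  open scoped MatrixOrder Matrix.Norms.L2Operator in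
  refine ⟨‖C‖, ?_⟩
  have h := IsSelfAdjoint.le_algebraMap_norm_self (a := C) hC
  rw [Matrix.le_iff, Algebra.algebraMap_eq_smul_one] at h
  simpa using h

end Generators

/-! ### A criterion for complete quotient maps -/

namespace OperatorSystem

variable {V : Type u} [AddCommGroup V] [Module ℂ V] {W : Type v} [AddCommGroup W] [Module ℂ W]

/-- A surjective unital completely positive map for which positive matrices lift approximately to
positive matrices induces a complete order isomorphism on the quotient by its kernel. -/
theorem IsUCP.exists_completeOrderIso {P : OperatorSystem V} {Q : OperatorSystem W}
    {f : V →ₗ[ℂ] W} (hf : P.IsUCP Q f) (hsurj : Function.Surjective f)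
    (hlift : ∀ k, ∀ M ∈ Q.cone k, ∀ ε : ℝ, 0 < ε → ∃ y ∈ P.cone k,
      y.map f = Matrix.diagonal (fun _ => (ε : ℂ) • Q.unit) + M)
    {J : Submodule ℂ V} (hJ : LinearMap.ker f = J) :
    ∃ (hk : IsKernel.{u, v} P J) (e : (V ⧸ J) ≃ₗ[ℂ] W),
      (∀ x : V, e (Submodule.Quotient.mk x) = f x) ∧ IsCompleteOrderIso (P.quotient J hk) Q e := by
  subst hJ
  let e := f.quotKerEquivOfSurjective hsurj
  have he : ∀ x, e (Submodule.Quotient.mk x) = f x := fun x => rfl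
  refine ⟨⟨W, _, _, Q, f, hf, rfl⟩, e, he, hf.map_unit, ?_, ?_⟩
  · rintro k M ⟨x, rfl, hx⟩
    change x.map f ∈ Q.cone k
    refine Q.archimedean k _ fun ε hε => ?_
    obtain ⟨κ, hκ, h⟩ := hx ε hε
    have h1 := hf.isCP k _ h
    have h2 : κ.map f = 0 := by
      ext i j
      exact hκ i j
    rwa [Matrix.map_add _ (map_add f), Matrix.map_add _ (map_add f), hf.map_diagonal, h2,
      add_zero] at h1
  · intro k M hM
    choose x hx using fun i j => hsurj (M i j)
    have e1 : M.map (e.symm : W →ₗ[ℂ] V ⧸ LinearMap.ker f) =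
        (Matrix.of x).map (Submodule.Quotient.mk (p := LinearMap.ker f)) := by
      ext i j
      change e.symm (M i j) = Submodule.Quotient.mk (x i j)
      rw [LinearEquiv.symm_apply_eq, he, hx]
    rw [e1]
    refine ⟨Matrix.of x, rfl, fun ε hε => ?_⟩
    obtain ⟨y, hy, h⟩ := hlift k M hM ε hε
    -- The correction is whatever makes the perturbed representative equal to the lift `y`; both
    -- have the same image, so it lies in the kernel.
    refine ⟨y - Matrix.diagonal (fun _ => (ε : ℂ) • P.unit) - Matrix.of x, fun i j => ?_, ?_⟩
    · have h1 := congrFun (congrFun h i) j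
      have h2 := congrFun (congrFun (hf.map_diagonal (k := k) (ε : ℂ)) i) j
      simp only [Matrix.map_apply, Matrix.add_apply] at h1 h2
      simp only [LinearMap.mem_ker, Matrix.sub_apply, Matrix.of_apply, map_sub, h1, h2, hx]
      abel
    · convert hy using 1
      abel

end OperatorSystem

/-! ### Complete positivity, the kernel, and lifting -/

section Main

open Matrix

variable {A : Type u} [CStarAlgebra A]

theorem CStarMatrix.nonneg_induction [PartialOrder A] [StarOrderedRing A] {k : ℕ}
    {p : CStarMatrix (Fin k) (Fin k) A → Prop} (hstar : ∀ B, p (star B * B)) (hzero : p 0)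
    (hadd : ∀ M N, p M → p N → p (M + N)) {M : CStarMatrix (Fin k) (Fin k) A} (hM : 0 ≤ M) :
    p M := by
  rw [StarOrderedRing.nonneg_iff] at hM
  induction hM using AddSubmonoid.closure_induction with
  | mem M h =>
    obtain ⟨B, rfl⟩ := h
    exact hstar B
  | zero => exact hzero
  | add M N _ _ h h' => exact hadd M N h h'

theorem sum_star_mul_nonneg [PartialOrder A] [StarOrderedRing A] {k : ℕ}
    {M : CStarMatrix (Fin k) (Fin k) A} (hM : 0 ≤ M) (p : Fin k → A) :
    0 ≤ ∑ i, star (p i) * ∑ j, M i j * p j := by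
  refine CStarMatrix.nonneg_induction (p := fun M => 0 ≤ ∑ i, star (p i) * ∑ j, M i j * p j)
    (fun B => ?_) (by simp) (fun M N h h' => ?_) hM
  swap
  · simpa [add_mul, Finset.sum_add_distrib, mul_add] using add_nonneg h h'
  have h : ∑ i, star (p i) * ∑ j, (star B * B) i j * p j =
      ∑ c, star (∑ i, B c i * p i) * ∑ j, B c j * p j := by
    simp only [CStarMatrix.mul_apply, CStarMatrix.star_apply, star_sum, StarMul.star_mul,
      Finset.sum_mul, Finset.mul_sum, mul_assoc]
    rw [Finset.sum_comm]
    conv_rhs =>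
      rw [Finset.sum_comm]
      enter [2, i]
      rw [Finset.sum_comm]
  rw [h]
  exact Finset.sum_nonneg fun c _ => star_mul_self_nonneg _

/-- As `ψ(X) = ∑ X_ij R_i* R_j`, a square `B* B` goes to a sum of squares, one for each row index
`l` of `M_{n+1}(ℂ)`. -/
theorem psi_map_nonneg [PartialOrder A] [StarOrderedRing A] {n k : ℕ} (S : Fin n → A)
    {M : CStarMatrix (Fin k) (Fin k) (MatAlg n)} (hM : 0 ≤ M) : 0 ≤ M.map (psi S) := by
  refine CStarMatrix.nonneg_induction (p := fun M => 0 ≤ M.map (psi S))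
    (fun B => ?_) (le_of_eq ?_) (fun M N h h' => ?_) hM
  rotate_left
  · ext i j
    simp
  · convert add_nonneg h h' using 1
    ext i j
    simp
  let N : Fin (n + 1) → CStarMatrix (Fin k) (Fin k) A := fun l =>
    CStarMatrix.ofMatrix (Matrix.of fun c j => ∑ i, B c j l i • rowR S () i)
  have h : (star B * B).map (psi S) = ∑ l, star (N l) * N l := by
    ext a b
    have e : psi S ((star B * B) a b) = ∑ i, ∑ j, ((star B * B) a b) i j •
        (star (rowR S () i) * rowR S () j) := by
      change ∑ i, ∑ j, _ • ((rowR S).conjTranspose * rowR S) i j = _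
      simp only [CStarMatrix.mul_apply, CStarMatrix.conjTranspose_apply, Finset.univ_unique,
        Finset.sum_singleton]
    rw [CStarMatrix.map_apply, e]
    simp only [CStarMatrix.sum_entry, CStarMatrix.mul_apply, CStarMatrix.star_apply, N,
      CStarMatrix.ofMatrix_apply, Matrix.of_apply, star_sum, star_smul, Finset.sum_mul,
      Finset.mul_sum, smul_mul_smul_comm, Finset.sum_smul]
    calc _ = ∑ i, ∑ j, ∑ c, ∑ l, (star (B c a l i) * B c b l j) •
          (star (rowR S () i) * rowR S () j) := rfl
      _ = ∑ i, ∑ c, ∑ j, ∑ l, (star (B c a l i) * B c b l j) •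
          (star (rowR S () i) * rowR S () j) :=
        Finset.sum_congr rfl fun _ _ => Finset.sum_comm
      _ = ∑ c, ∑ i, ∑ j, ∑ l, (star (B c a l i) * B c b l j) •
          (star (rowR S () i) * rowR S () j) := Finset.sum_comm
      _ = ∑ c, ∑ i, ∑ l, ∑ j, (star (B c a l i) * B c b l j) •
          (star (rowR S () i) * rowR S () j) :=
        Finset.sum_congr rfl fun _ _ => Finset.sum_congr rfl fun _ _ => Finset.sum_comm
      _ = ∑ c, ∑ l, ∑ i, ∑ j, (star (B c a l i) * B c b l j) •
          (star (rowR S () i) * rowR S () j) :=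
        Finset.sum_congr rfl fun _ _ => Finset.sum_comm
      _ = _ := by
        rw [Finset.sum_comm]
        exact Finset.sum_congr rfl fun _ _ => Finset.sum_congr rfl fun _ _ => Finset.sum_comm
  rw [h]
  exact Finset.sum_nonneg fun l _ => star_mul_self_nonneg _

theorem exists_coeff_spaceS {n : ℕ} {S : Fin n → A} {x : A} (hx : x ∈ spaceS S) :
    ∃ (c : ℂ) (a b : Fin n → ℂ), x = c • (1 : A) + ∑ l, a l • S l + ∑ l, b l • star (S l) := by
  induction hx using Submodule.span_induction with
  | mem x hx =>
    rcases hx with (rfl | ⟨i, rfl⟩) | ⟨i, rfl⟩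
    · exact ⟨1, 0, 0, by simp⟩
    · exact ⟨0, Pi.single i 1, 0, by simp [Pi.single_apply]⟩
    · exact ⟨0, 0, Pi.single i 1, by simp [Pi.single_apply]⟩
  | zero => exact ⟨0, 0, 0, by simp⟩
  | add x y _ _ hx hy =>
    obtain ⟨c, a, b, rfl⟩ := hx
    obtain ⟨c', a', b', rfl⟩ := hy
    refine ⟨c + c', a + a', b + b', ?_⟩
    simp only [Pi.add_apply, add_smul, Finset.sum_add_distrib]
    abel
  | smul t x _ hx =>
    obtain ⟨c, a, b, rfl⟩ := hx
    exact ⟨t * c, t • a, t • b, by simp [mul_smul, Finset.smul_sum]⟩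

theorem exists_coeff_spaceE {n : ℕ} (x : spaceE n) :
    ∃ (c d : ℂ) (a b : Fin n → ℂ), x = c • genCorner n + ∑ l, a l • genCol l +
      ∑ l, b l • genRow l + d • genDiag n := by
  obtain ⟨x, hx⟩ := x
  suffices ∃ (c d : ℂ) (a b : Fin n → ℂ), x = ((c • genCorner n + ∑ l, a l • genCol l +
      ∑ l, b l • genRow l + d • genDiag n : spaceE n) : MatAlg n) by
    obtain ⟨c, d, a, b, h⟩ := this
    exact ⟨c, d, a, b, Subtype.ext h⟩
  induction hx using Submodule.span_induction with
  | mem x hx =>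
    rcases hx with ((rfl | ⟨i, rfl⟩) | ⟨i, rfl⟩) | rfl
    · exact ⟨1, 0, 0, 0, by simp [genCorner]⟩
    · exact ⟨0, 0, 0, Pi.single i 1, by simp [Pi.single_apply, genRow]⟩
    · exact ⟨0, 0, Pi.single i 1, 0, by simp [Pi.single_apply, genCol]⟩
    · exact ⟨0, 1, 0, 0, by simp [genDiag]⟩
  | zero => exact ⟨0, 0, 0, 0, by simp⟩
  | add x y _ _ hx hy =>
    obtain ⟨c, d, a, b, rfl⟩ := hx
    obtain ⟨c', d', a', b', rfl⟩ := hy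
    refine ⟨c + c', d + d', a + a', b + b', ?_⟩
    rw [← Submodule.coe_add]
    congr 1
    simp only [Pi.add_apply, add_smul, Finset.sum_add_distrib]
    abel
  | smul t x _ hx =>
    obtain ⟨c, d, a, b, rfl⟩ := hx
    refine ⟨t * c, t * d, t • a, t • b, ?_⟩
    rw [← Submodule.coe_smul]
    congr 1
    simp [mul_smul, Finset.smul_sum]

theorem exists_eq_pencil {n k : ℕ} {S : Fin n → A} {M : Matrix (Fin k) (Fin k) (spaceS S)}
    (hM : ∀ i j, star (M j i : A) = M i j) :
    ∃ (A₀ : Matrix (Fin k) (Fin k) ℂ) (a : Fin n → Matrix (Fin k) (Fin k) ℂ), A₀.IsHermitian ∧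
      ∀ i j, (M i j : A) = pencil S A₀ a i j := by
  choose c a b h using fun i j => exists_coeff_spaceS (M i j).2
  have h2 : star (2⁻¹ : ℂ) = 2⁻¹ := by simp
  -- Averaging arbitrary coefficients with their adjoints gives the self-adjoint form without appeal
  -- to their uniqueness.
  refine ⟨(2⁻¹ : ℂ) • (Matrix.of c + (Matrix.of c)ᴴ), fun l => (2⁻¹ : ℂ) •
    (Matrix.of (fun i j => a i j l) + (Matrix.of fun i j => b i j l)ᴴ), ?_, fun i j => ?_⟩
  · rw [Matrix.IsHermitian, Matrix.conjTranspose_smul, Matrix.conjTranspose_add,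
      Matrix.conjTranspose_conjTranspose, h2, add_comm]
  · have h3 : (M i j : A) = (2⁻¹ : ℂ) • ((M i j : A) + star (M j i : A)) := by
      rw [hM, ← two_smul ℂ, smul_smul]
      norm_num
    rw [h3, h i j, h j i]
    simp only [pencil, Matrix.of_apply, Matrix.smul_apply, Matrix.add_apply,
      Matrix.conjTranspose_apply, star_add, star_smul, star_sum, star_star, star_one, smul_eq_mul,
      StarMul.star_mul, h2, mul_smul, add_smul, smul_add, Finset.sum_add_distrib, Finset.smul_sum,
      mul_comm _ (2⁻¹ : ℂ)]
    abel

variable {n : ℕ} {S : Fin n → A}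

theorem phi_surjective (hS : IsCuntzFamily S) : Function.Surjective (phi hS) := by
  rintro ⟨y, hy⟩
  obtain ⟨c, a, b, rfl⟩ := exists_coeff_spaceS hy
  refine ⟨(2 : ℂ) • (c • genCorner n + ∑ l, a l • genCol l + ∑ l, b l • genRow l),
    Subtype.ext ?_⟩
  simp only [map_add, map_sum, map_smul, Submodule.coe_add, Submodule.coe_sum,
    Submodule.coe_smul, phi_genCorner, phi_genRow, phi_genCol, smul_comm _ (2⁻¹ : ℂ),
    ← Finset.smul_sum, ← smul_add]
  simp

variable [PartialOrder A] [StarOrderedRing A]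

theorem phi_isUCP (hS : IsCuntzFamily S) : (systemE n).IsUCP (systemS S) (phi hS) where
  map_unit := Subtype.ext (psi_one hS)
  isCP _ _ hM := psi_map_nonneg S hM

variable [Nontrivial A]

/-- A vacuum map reads off `c` directly, `a i` after left multiplication by `S_i*`, and `b i` after
right multiplication by `S_i`. Words of length two appear, so the bound is `2`. -/
theorem IsCuntzFamily.coeff_eq_zero (hS : IsCuntzFamily S) (hn : 1 ≤ n) {c : ℂ} {a b : Fin n → ℂ}
    (h : c • (1 : A) + ∑ l, a l • S l + ∑ l, b l • star (S l) = 0) : c = 0 ∧ a = 0 ∧ b = 0 := by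
  obtain ⟨Φ⟩ := hS.exists_vacuumMap hn 2
  let s : Fin n → Φ.domain := fun i => ⟨S i, Φ.mem_domain i⟩
  have horth : ∀ i j, star (s i) * s j = if i = j then 1 else 0 := fun i j => by
    apply Subtype.ext
    change star (S i) * S j = _
    rw [hS.star_gen_mul_gen]
    split_ifs <;> rfl
  have h' : c • (1 : Φ.domain) + ∑ l, a l • s l + ∑ l, b l • star (s l) = 0 := by
    apply Subtype.ext
    simpa [s] using h
  have hw1 : ∀ i, Φ.toLin (s i) = 0 := fun i =>
    Φ.map_word _ (wordSpan_mono s le_rfl one_le_two (gen_mem_wordSpan s i))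
  have hw1' : ∀ i, Φ.toLin (star (s i)) = 0 := fun i =>
    Φ.map_star_word _ (wordSpan_mono s le_rfl one_le_two (gen_mem_wordSpan s i))
  have hw2 : ∀ i j, Φ.toLin (s i * s j) = 0 := fun i j =>
    Φ.map_word _ (wordSpan_mono (a := 1 + 1) (b := 1 + 1) s (by omega) le_rfl
      (mul_mem_wordSpan (gen_mem_wordSpan s i) (gen_mem_wordSpan s j)))
  have hw2' : ∀ i j, Φ.toLin (star (s i) * star (s j)) = 0 := fun i j => by
    rw [← StarMul.star_mul]
    exact Φ.map_star_word _ (wordSpan_mono (a := 1 + 1) (b := 1 + 1) s (by omega) le_rfl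
      (mul_mem_wordSpan (gen_mem_wordSpan s j) (gen_mem_wordSpan s i)))
  have key : ∀ t : ℂ, t • Φ.toLin 1 = 0 → t = 0 := fun t ht =>
    (smul_eq_zero.1 ht).resolve_right Φ.map_one_ne
  refine ⟨key c ?_, funext fun i => key _ ?_, funext fun i => key _ ?_⟩
  · have := congrArg Φ.toLin h'
    simpa [hw1, hw1'] using this
  · have := congrArg (fun x => Φ.toLin (star (s i) * x)) h'
    simpa [mul_add, Finset.mul_sum, horth, hw1', hw2', apply_ite Φ.toLin] using this
  · have := congrArg (fun x => Φ.toLin (x * s i)) h'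
    simpa [add_mul, Finset.sum_mul, horth, hw1, hw2, apply_ite Φ.toLin] using this

theorem ker_phi (hS : IsCuntzFamily S) (hn : 1 ≤ n) : LinearMap.ker (phi hS) = spaceJ n := by
  ext x
  rw [LinearMap.mem_ker, spaceJ, Submodule.mem_comap, Submodule.mem_span_singleton]
  constructor
  · intro hx
    obtain ⟨c, d, a, b, rfl⟩ := exists_coeff_spaceE x
    have h := congrArg Subtype.val hx
    have h' : (2⁻¹ * (c + d)) • (1 : A) + ∑ l, (2⁻¹ * a l) • S l +
        ∑ l, (2⁻¹ * b l) • star (S l) = 0 := by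
      refine Eq.trans ?_ h
      simp only [map_add, map_sum, map_smul, Submodule.coe_add, Submodule.coe_sum,
        Submodule.coe_smul, phi_genCorner, phi_genRow, phi_genCol, phi_genDiag, smul_smul,
        mul_comm _ (2⁻¹ : ℂ), mul_add, add_smul]
      abel
    obtain ⟨h1, h2, h3⟩ := hS.coeff_eq_zero hn h'
    have h2' : ∀ l, a l = 0 := fun l => by simpa using congrFun h2 l
    have h3' : ∀ l, b l = 0 := fun l => by simpa using congrFun h3 l
    have h1' : d = -c := by
      rw [mul_eq_zero, or_iff_right (by norm_num), add_comm] at h1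
      exact eq_neg_of_add_eq_zero_left h1
    refine ⟨c, ?_⟩
    simp [h1', h2', h3', genCorner, genDiag, sub_eq_add_neg]
  · rintro ⟨t, ht⟩
    have hx : x = t • (genCorner n - genDiag n) := Subtype.ext ht.symm
    rw [hx, map_smul, map_sub]
    have : phi hS (genCorner n) = phi hS (genDiag n) :=
      Subtype.ext ((phi_genCorner hS).trans (phi_genDiag hS).symm)
    rw [this, sub_self, smul_zero]

/-- Both claims are proved together: the elimination for `C_m` needs the earlier `C_j` invertible,
and the bound `C_m ≥ ε` then makes `C_m` positive definite. Each `m` uses its own vacuum map, of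
length `m + 1`. -/
theorem posSemidef_schurSeq_sub_of_nonneg (hS : IsCuntzFamily S) (hn : 1 ≤ n) {k : ℕ}
    {A₀ : Matrix (Fin k) (Fin k) ℂ} (hA : A₀.IsHermitian) (a : Fin n → Matrix (Fin k) (Fin k) ℂ)
    (hM : 0 ≤ CStarMatrix.ofMatrix (pencil S A₀ a)) {ε : ℝ} (hε : 0 < ε) (m : ℕ) :
    (schurSeq (A₀ + (ε : ℂ) • 1) a m - (ε : ℂ) • 1).PosSemidef ∧
      (schurSeq (A₀ + (ε : ℂ) • 1) a m).PosDef := by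
  induction m using Nat.strong_induction_on with
  | _ m ih =>
  obtain ⟨Φ⟩ := hS.exists_vacuumMap hn (m + 1)
  let s : Fin n → Φ.domain := fun i => ⟨S i, Φ.mem_domain i⟩
  have horth : ∀ i j, star (s i) * s j = if i = j then 1 else 0 := fun i j => by
    apply Subtype.ext
    change star (S i) * S j = _
    rw [hS.star_gen_mul_gen]
    split_ifs <;> rfl
  have hunit : ∀ j < m, IsUnit (schurSeq (A₀ + (ε : ℂ) • 1) a j).det := fun j hj =>
    (Matrix.isUnit_iff_isUnit_det _).1 (ih j hj).2.isUnit
  have h := posSemidef_schurSeq_sub horth hA a hunit Φ.toLin (Φ.nonneg 1 zero_le_one) Φ.map_one_ne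
    Φ.map_word Φ.map_star_word fun p q => by
      apply Φ.nonneg
      have h1 := sum_star_mul_nonneg hM fun i => (p i : A)
      have h2 : 0 ≤ (ε : ℂ) • ∑ i, star (q i : A) * (q i : A) :=
        smul_nonneg (Complex.zero_le_real.2 hε.le)
          (Finset.sum_nonneg fun i _ => star_mul_self_nonneg _)
      have h3 : ∀ i j, ((pencil s A₀ a i j : Φ.domain) : A) = pencil S A₀ a i j := fun i j => by
        simp [pencil, s]
      convert add_nonneg h1 h2 using 1
      simp [h3]
  refine ⟨h, ?_⟩
  have h4 : ((ε : ℂ) • (1 : Matrix (Fin k) (Fin k) ℂ)).PosDef :=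
    Matrix.PosDef.one.smul (Complex.zero_lt_real.2 hε)
  simpa using h4.posSemidef_add h

/-- Positive matrices over `S_n` lift, up to `ε`, to positive matrices over `E_n`. -/
theorem exists_lift_mem_cone (hS : IsCuntzFamily S) (hn : 1 ≤ n) (k : ℕ)
    (M : Matrix (Fin k) (Fin k) (spaceS S)) (hM : M ∈ (systemS S).cone k) (ε : ℝ) (hε : 0 < ε) :
    ∃ y ∈ (systemE n).cone k,
      y.map (phi hS) = Matrix.diagonal (fun _ => (ε : ℂ) • (systemS S).unit) + M := by
  obtain ⟨A₀, a, hA, hpen⟩ := exists_eq_pencil fun i j =>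
    congrArg Subtype.val ((systemS S).cone_adj k M hM i j)
  have hM' : 0 ≤ CStarMatrix.ofMatrix (pencil S A₀ a) := by
    have e : M.map (Subtype.val : spaceS S → A) = pencil S A₀ a := by
      ext i j
      exact hpen i j
    rw [← e]
    exact hM
  -- One half of `ε` keeps the Schur complements positive definite; the other half will absorb the
  -- boundary term `A₁ - C_m`.
  have hC := posSemidef_schurSeq_sub_of_nonneg hS hn hA a hM' (half_pos hε)
  set A₁ := A₀ + ((ε / 2 : ℝ) : ℂ) • (1 : Matrix (Fin k) (Fin k) ℂ) with hA₁
  obtain ⟨r, hr⟩ := exists_posSemidef_smul_one_sub (hC 0).2.isHermitian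
  -- Large enough that `m ε / 2` dominates the bound `r` of `A₁ = C₀`; the maximum with `0` also
  -- allows division by `m`.
  obtain ⟨m, hm⟩ := exists_nat_gt (max 0 (r / (ε / 2)))
  have hm0 : (0 : ℝ) < m := (le_max_left _ _).trans_lt hm
  have hmr : r ≤ m * (ε / 2) := ((div_lt_iff₀ (half_pos hε)).1 ((le_max_right _ _).trans_lt hm)).le
  obtain ⟨B, C, hBC, hsum⟩ := exists_arrow_mem_cone (fun m => (hC m).2) m
  -- Chosen so that `B + C + F = m (A₁ + ε / 2) = m (A₀ + ε)`. It is positive as the sum of `m ε / 2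
  -- - r`, `r - A₁` and `C_m`.
  let F : Matrix (Fin k) (Fin k) ℂ := ((m * (ε / 2) : ℝ) : ℂ) • 1 - A₁ + schurSeq A₁ a m
  have hF : F.PosSemidef := by
    have h1 : (((m * (ε / 2) - r : ℝ) : ℂ) • (1 : Matrix (Fin k) (Fin k) ℂ)).PosSemidef :=
      Matrix.PosSemidef.one.smul (Complex.zero_le_real.2 (sub_nonneg.2 hmr))
    have h2 := (h1.add hr).add (hC m).2.posSemidef
    convert h2 using 1
    simp only [F, schurSeq, Complex.ofReal_sub, sub_smul]
    abel
  -- The factor `1 / m` undoes the summation, and `2` undoes the `1 / 2` in `φ`.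
  have hy := (systemE n).cone_smul ((systemE n).cone_add k _ hBC _
    (arrow_mem_cone_of_posSemidef hF)) (r := 2 / m) (by positivity)
  refine ⟨_, hy, ?_⟩
  ext1 i j
  apply Subtype.ext
  rw [arrow_add, add_zero, add_zero, Matrix.map_apply, Matrix.smul_apply, map_smul,
    Submodule.coe_smul, arrow_map_phi, Matrix.add_apply, Submodule.coe_add, hpen]
  have e1 : B + F + C = (m : ℂ) • (A₀ + (ε : ℂ) • 1) := by
    have : B + F + C = (B + C) + F := by abel
    rw [this, hsum, hA₁, ← Nat.cast_smul_eq_nsmul ℂ]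
    simp only [F, hA₁]
    have e2 : ((m * (ε / 2) : ℝ) : ℂ) • (1 : Matrix (Fin k) (Fin k) ℂ) =
        (m : ℂ) • ((ε / 2 : ℝ) : ℂ) • 1 := by
      rw [smul_smul]
      push_cast
      rfl
    have e3 : (ε : ℂ) • (1 : Matrix (Fin k) (Fin k) ℂ) =
        ((ε / 2 : ℝ) : ℂ) • 1 + ((ε / 2 : ℝ) : ℂ) • 1 := by
      rw [← add_smul, ← Complex.ofReal_add, add_halves]
    rw [e2, e3]
    simp only [smul_add]
    abel
  have e4 : pencil S ((m : ℂ) • (A₀ + (ε : ℂ) • 1)) (m • a) i j =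
      (m : ℂ) • pencil S (A₀ + (ε : ℂ) • 1) a i j := by
    rw [← Nat.cast_smul_eq_nsmul ℂ]
    simp [pencil, Finset.smul_sum, mul_smul]
  have e5 : (((2 / m : ℝ) : ℂ) * 2⁻¹) * (m : ℂ) = 1 := by
    have : (m : ℂ) ≠ 0 := by exact_mod_cast hm0.ne'
    push_cast
    field_simp
  rw [e1, e4, smul_smul, smul_smul, e5, one_smul, pencil_add_apply, add_comm]
  congr 1
  by_cases hij : i = j
  · subst hij
    simp [systemS, OperatorSystem.ofSubmodule]
  · simp [hij]

end Main

theorem mainTheorem1 {A : Type u} [CStarAlgebra A] [PartialOrder A] [StarOrderedRing A]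
    [Nontrivial A] (n : ℕ) (hn : 1 ≤ n) (S : Fin n → A) (hS : IsCuntzFamily S) :
    psi S 1 = 1 ∧ (∃ Ψ : MatAlg n →CP A, Ψ.toLinearMap = psi S) ∧
    (systemE n).IsUCP (systemS S) (phi hS) ∧
    LinearMap.ker (phi hS) = spaceJ n ∧
    (∃ (hJ : OperatorSystem.IsKernel.{0, u} (systemE n) (spaceJ n))
      (e : (spaceE n ⧸ spaceJ n) ≃ₗ[ℂ] spaceS S),
      (∀ x : spaceE n, e (Submodule.Quotient.mk x) = phi hS x) ∧
      ((systemE n).quotient (spaceJ n) hJ).IsCompleteOrderIso (systemS S) e) ∧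
    (systemE n).IsCompleteQuotientMap (systemS S) (phi hS) := by
  have h := (phi_isUCP hS).exists_completeOrderIso (phi_surjective hS)
    (exists_lift_mem_cone hS hn) (ker_phi hS hn)
  have h' := (phi_isUCP hS).exists_completeOrderIso (phi_surjective hS)
    (exists_lift_mem_cone hS hn) rfl
  exact ⟨psi_one hS, ⟨⟨psi S, fun _ _ hM => psi_map_nonneg S hM⟩, rfl⟩, phi_isUCP hS, ker_phi hS hn,
    h, (phi_isUCP hS).isCP, h'⟩
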